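/- Let $\gamma_1>\gamma_2>1$ and $0<s<1/2$ be fixed. Then there exist constants $C_1,C_2,C_3>0$, not depending on $k$, such that the following holds for every integer $k\ge 2$ for which $p:=\gamma_1\frac{\log k}{k}$ and $q:=\gamma_2\frac{\log k}{k}$ are at most $1$. Let $A=(a_{ij})$ be the random signed adjacency matrix of $\mathsf{SignedBlock}_k(p,q,s)$: on the nodes $[2k]$, split into the communities $[k]$ and $[2k]\setminus[k]$, each pair $\{i,j\}$ of distinct nodes is an edge with probability $p_{ij}$ and is given a negative sign with probability $s_{ij}$, all these choices being mutually independent, where $p_{ij}=p,\ s_{ij}=s$ if $i\neq j$ lie in the same community, $p_{ij}=q,\ s_{ij}=1-s$ if $i,j$ lie in different communities, and $p_{ii}=s_{ii}=0$. Here $a_{ij}=a_{ji}\in\{1,-1\}$ is the sign of $\{i,j\}$ if it is an edge, and $a_{ij}=0$ otherwise. Let $D$ be the diagonal matrix of the degrees $d_i=\#\{j: a_{ij}\ne 0\}$ and let $$\mathcal{L}=D^{-1/2}(D-A)D^{-1/2}$$ be the normalized signed Laplacian, where $(D^{-1/2})_{ii}:=0$ if $d_i=0$. Let $\overline{A}=\big(p_{ij}(1-2s_{ij})\big)_{i,j}$,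 let $\overline{D}$ be the diagonal matrix of the expected degrees $\overline{d}_i=\sum_j p_{ij}$, and let $\overline{\mathcal{L}}=\overline{D}^{-1/2}(\overline{D}-\overline{A})\overline{D}^{-1/2}$. Then, with probability at least $1-C_1k^{-C_2}$, $$\|\mathcal{L}-\overline{\mathcal{L}}\|_{\mathrm{op}}\le C_3(\log k)^{-1/2},$$ where $\|\cdot\|_{\mathrm{op}}$ is the $\ell_2$-operator (spectral) norm. -/

import Mathlib

open MeasureTheory ProbabilityTheory

namespace SignedGraph

/-! ### Signed graphs and their Laplacians

A signed graph on `Fin n` is encoded by its signed adjacency matrix `A`: the entry `A i j` is the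
sign `1` or `-1` of the edge `{i, j}`, and it is `0` when `i` and `j` are not adjacent. -/

/-- The degree of node `i`: the number of edges of the signed graph that are incident to `i`. -/
noncomputable def degree {n : ℕ} (A : Matrix (Fin n) (Fin n) ℝ) (i : Fin n) : ℕ :=
  {j : Fin n | A i j ≠ 0}.ncard

/-- `D ^ (-1/2)` for the diagonal matrix `D` with nonnegative diagonal `d`, with the convention
that the `i`-th diagonal entry is `0` whenever `d i = 0`. -/
noncomputable def invSqrtDiag {n : ℕ} (d : Fin n → ℝ) : Matrix (Fin n) (Fin n) ℝ :=
  Matrix.diagonal fun i => if d i = 0 then 0 else 1 / Real.sqrt (d i)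

/-- The signed Laplacian `D - A` normalized by `D`, i.e. `D ^ (-1/2) * (D - A) * D ^ (-1/2)`, where
`D` is the diagonal matrix with diagonal `d`. -/
noncomputable def normalize {n : ℕ} (d : Fin n → ℝ) (A : Matrix (Fin n) (Fin n) ℝ) :
    Matrix (Fin n) (Fin n) ℝ :=
  invSqrtDiag d * (Matrix.diagonal d - A) * invSqrtDiag d

/-- The normalized signed Laplacian of the signed graph with signed adjacency matrix `A`. -/
noncomputable def normLaplacian {n : ℕ} (A : Matrix (Fin n) (Fin n) ℝ) :
    Matrix (Fin n) (Fin n) ℝ :=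
  normalize (fun i => (degree A i : ℝ)) A

/-- The `ℓ²`-operator norm (spectral norm) of a real square matrix. -/
noncomputable def opNorm {n : ℕ} (M : Matrix (Fin n) (Fin n) ℝ) : ℝ :=
  ‖Matrix.toEuclideanCLM (n := Fin n) (𝕜 := ℝ) M‖

/-! ### The signed inhomogeneous Erdős–Rényi model -/

/-- The set of unordered pairs of distinct nodes, each written as `(i, j)` with `i < j`. -/
abbrev Pairs (n : ℕ) : Type := {e : Fin n × Fin n // e.1 < e.2}

/-- The signed adjacency matrix obtained from, for each pair `e`, a number `(ω e).1` (equal to `1`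
if the edge `e` is present and to `0` otherwise) and a number `(ω e).2` (equal to `1` if the sign
drawn for `e` is negative and to `0` otherwise). -/
noncomputable def assemble {n : ℕ} (ω : Pairs n → ℝ × ℝ) : Matrix (Fin n) (Fin n) ℝ :=
  Matrix.of fun i j =>
    if h : i < j then (ω ⟨(i, j), h⟩).1 * (1 - 2 * (ω ⟨(i, j), h⟩).2)
    else if h : j < i then (ω ⟨(j, i), h⟩).1 * (1 - 2 * (ω ⟨(j, i), h⟩).2)
    else 0

/-- Matrices carry the product σ-algebra. -/
instance instMeasurableSpaceMatrix {n : ℕ} : MeasurableSpace (Matrix (Fin n) (Fin n) ℝ) :=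
  inferInstanceAs (MeasurableSpace (Fin n → Fin n → ℝ))

/-- The distribution of the random signed adjacency matrix of the signed inhomogeneous
Erdős–Rényi model with (symmetric) edge probabilities `P` and negative-sign probabilities `S`:
independently over all pairs `i < j`, and independently of each other, the edge is present with
probability `P i j` and its sign is negative with probability `S i j`.
Here `bernoulliMeasure 1 0 p` gives mass `p` to `1` and mass `1 - p` to `0`. -/
noncomputable def signedErdosRenyi {n : ℕ} (P S : Matrix (Fin n) (Fin n) unitInterval) :
    Measure (Matrix (Fin n) (Fin n) ℝ) :=
  (Measure.pi fun e : Pairs n =>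
    (bernoulliMeasure (1 : ℝ) 0 (P e.1.1 e.1.2)).prod
      (bernoulliMeasure (1 : ℝ) 0 (S e.1.1 e.1.2))).map assemble

/-- The mean signed adjacency matrix, with entries `p i j * (1 - 2 * s i j)`. -/
noncomputable def meanAdj {n : ℕ} (P S : Matrix (Fin n) (Fin n) unitInterval) :
    Matrix (Fin n) (Fin n) ℝ :=
  Matrix.of fun i j => (P i j : ℝ) * (1 - 2 * (S i j : ℝ))

/-- The expected degree of node `i`. -/
noncomputable def meanDegree {n : ℕ} (P : Matrix (Fin n) (Fin n) unitInterval) (i : Fin n) : ℝ :=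
  ∑ j, (P i j : ℝ)

/-- The degree-normalized mean Laplacian: the mean signed Laplacian, normalized by the diagonal
matrix of expected degrees. -/
noncomputable def meanNormLaplacian {n : ℕ} (P S : Matrix (Fin n) (Fin n) unitInterval) :
    Matrix (Fin n) (Fin n) ℝ :=
  normalize (meanDegree P) (meanAdj P S)

/-! ### The signed stochastic bisection model -/

/-- The community (`0` or `1`) of a node of `Fin (2 * k)`: the first `k` nodes form community `0`,
the last `k` nodes community `1`. -/
def community {k : ℕ} (i : Fin (2 * k)) : Fin 2 := if i.val < k then 0 else 1

/-- The extension of a `2 × 2` matrix of probabilities to a matrix indexed by the nodes, constant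
on blocks, with zero diagonal. -/
def blockExtend {k : ℕ} (Q : Matrix (Fin 2) (Fin 2) unitInterval) :
    Matrix (Fin (2 * k)) (Fin (2 * k)) unitInterval :=
  Matrix.of fun i j => if i = j then 0 else Q (community i) (community j)

/-- Edge probabilities: `p` inside the communities and `q` between them. -/
def edgeProb (k : ℕ) (p q : unitInterval) : Matrix (Fin (2 * k)) (Fin (2 * k)) unitInterval :=
  blockExtend !![p, q; q, p]

/-- Negative-sign probabilities: `s` inside the communities and `1 - s` between them. -/
def signProb (k : ℕ) (s : unitInterval) : Matrix (Fin (2 * k)) (Fin (2 * k)) unitInterval :=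
  blockExtend !![s, unitInterval.symm s; unitInterval.symm s, s]

/-- The distribution of the random signed adjacency matrix of the signed stochastic bisection
model `SignedBlock_k(p, q, s)`. -/
noncomputable def signedBlock (k : ℕ) (p q s : unitInterval) :
    Measure (Matrix (Fin (2 * k)) (Fin (2 * k)) ℝ) :=
  signedErdosRenyi (edgeProb k p q) (signProb k s)

end SignedGraph

/-! Write `l = log k`. All expected degrees and the quantity `2 * k * p` are of order `l`. The
estimate is deterministic on a regular event: every degree is at least `l / 8`, and both the signed
and the unsigned adjacency matrix lie within `N = K * √l` of their means in operator norm.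

On that event (`opNorm_normalize_sub_le`) the difference of Laplacians splits into a term with the
centered adjacency matrix, of size `N / l`, and two terms with the difference `v` of the inverse
square roots of the degrees. A single degree may deviate from its mean by order `l`, so a uniform
bound on `v` would give only `O(1)`. Instead `v` is controlled in `ℓ²`: the vector of degree
deviations is the centered unsigned adjacency matrix applied to the all-ones vector, so its squared
length is at most `n * N ^ 2`. The mean adjacency matrix has all entries at most `p`, so a Frobenius
bound turns this into `n * p * N / l ^ 2`, again of order `l ^ (-1/2)`.

The degree bound is a Chernoff estimate with a union bound (`measure_row_sum_le`); mean degrees of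
at least `2 * l - 1` leave room for it. The norm bound `√l` is the hard part (`exists_opNorm_tail`),
because a generic matrix concentration inequality would lose a factor `√l`. It comes from the trace
method with a comparison of moments. In the expectation of the trace of `X ^ (2 * m)` only closed
walks using each edge at least twice survive, each contributing at most `p` per distinct edge. A
coincidence pattern with `V` vertices has at most `n ^ V` realisations and at least `V - 1` edges,
hence total weight at most `n * (n * p) ^ (V - 1)`. If `r ≥ n * p + m + 1`, this is at most `n`
times the number of realisations in `Fin r` (`sum_pow_numEdges_le`). The sparse trace moment is thus
at most `n` times that of a dense `r × r` matrix with centered bounded entries whose higher moments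
are at least `1`. For `r` proportional to `m`, a net of the unit ball and subgaussian tails bound
the latter by `(C * m) ^ m`; Markov's inequality with `m` of order `l` finishes. -/

namespace SignedGraph

/-! ### The operator norm -/

section OpNorm

open scoped Matrix.Norms.L2Operator

variable {n : ℕ}

theorem opNorm_eq_norm (M : Matrix (Fin n) (Fin n) ℝ) : opNorm M = ‖M‖ := rfl

theorem opNorm_nonneg (M : Matrix (Fin n) (Fin n) ℝ) : 0 ≤ opNorm M := norm_nonneg _

theorem opNorm_add_le (M N : Matrix (Fin n) (Fin n) ℝ) :
    opNorm (M + N) ≤ opNorm M + opNorm N := by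
  simp only [opNorm_eq_norm]; exact norm_add_le M N

theorem opNorm_mul_le (M N : Matrix (Fin n) (Fin n) ℝ) :
    opNorm (M * N) ≤ opNorm M * opNorm N := by
  simp only [opNorm_eq_norm]; exact Matrix.l2_opNorm_mul M N

theorem opNorm_smul (c : ℝ) (M : Matrix (Fin n) (Fin n) ℝ) :
    opNorm (c • M) = |c| * opNorm M := by
  simp only [opNorm_eq_norm, norm_smul, Real.norm_eq_abs]

theorem opNorm_sub_comm (M N : Matrix (Fin n) (Fin n) ℝ) : opNorm (M - N) = opNorm (N - M) := by
  simp only [opNorm_eq_norm]; exact norm_sub_rev M N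

theorem opNorm_diagonal_le {v : Fin n → ℝ} {c : ℝ} (hc : 0 ≤ c) (hv : ∀ i, |v i| ≤ c) :
    opNorm (Matrix.diagonal v) ≤ c := by
  rw [opNorm_eq_norm, Matrix.l2_opNorm_diagonal]
  exact (pi_norm_le_iff_of_nonneg hc).2 hv

theorem opNorm_sq_le_sum_sq (M : Matrix (Fin n) (Fin n) ℝ) :
    opNorm M ^ 2 ≤ ∑ i, ∑ j, M i j ^ 2 := by
  have h0 : 0 ≤ ∑ i, ∑ j, M i j ^ 2 := by positivity
  rw [← Real.sq_sqrt h0]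
  refine pow_le_pow_left₀ (opNorm_nonneg _) ?_ 2
  refine ContinuousLinearMap.opNorm_le_bound _ (Real.sqrt_nonneg _) fun x => ?_
  rw [EuclideanSpace.norm_eq, EuclideanSpace.norm_eq, ← Real.sqrt_mul h0]
  refine Real.sqrt_le_sqrt ?_
  rw [Finset.sum_mul]
  refine Finset.sum_le_sum fun i _ => ?_
  simp only [Matrix.ofLp_toEuclideanCLM, Real.norm_eq_abs, sq_abs, Matrix.mulVec, dotProduct]
  exact Finset.sum_mul_sq_le_sq_mul_sq _ _ _

theorem sum_sq_mulVec_le (M : Matrix (Fin n) (Fin n) ℝ) (v : Fin n → ℝ) :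
    ∑ i, (M.mulVec v) i ^ 2 ≤ opNorm M ^ 2 * ∑ i, v i ^ 2 := by
  have h := (Matrix.toEuclideanCLM (n := Fin n) (𝕜 := ℝ) M).le_opNorm (WithLp.toLp 2 v)
  have h2 := pow_le_pow_left₀ (norm_nonneg _) h 2
  rw [mul_pow, EuclideanSpace.norm_sq_eq, EuclideanSpace.norm_sq_eq] at h2
  simpa [opNorm] using h2

theorem abs_dotProduct_mulVec_le (M : Matrix (Fin n) (Fin n) ℝ) (x y : EuclideanSpace ℝ (Fin n)) :
    |x.ofLp ⬝ᵥ M.mulVec y.ofLp| ≤ opNorm M * ‖x‖ * ‖y‖ := by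
  rw [← Matrix.inner_toEuclideanCLM]
  calc _ ≤ ‖x‖ * ‖Matrix.toEuclideanCLM (n := Fin n) (𝕜 := ℝ) M y‖ := abs_real_inner_le_norm _ _
    _ ≤ ‖x‖ * (opNorm M * ‖y‖) := by
        gcongr; exact ContinuousLinearMap.le_opNorm _ _
    _ = _ := by ring

theorem opNorm_le_of_dotProduct_le {M : Matrix (Fin n) (Fin n) ℝ} {c : ℝ} (hc : 0 ≤ c)
    (h : ∀ x y : EuclideanSpace ℝ (Fin n), ‖x‖ ≤ 1 → ‖y‖ ≤ 1 →
      |x.ofLp ⬝ᵥ M.mulVec y.ofLp| ≤ c) : opNorm M ≤ c := by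
  refine ContinuousLinearMap.opNorm_le_of_unit_norm hc fun y hy => ?_
  set z := Matrix.toEuclideanCLM (n := Fin n) (𝕜 := ℝ) M y with hz
  rcases eq_or_ne z 0 with h0 | h0
  · rw [h0, norm_zero]; exact hc
  have hz0 : 0 < ‖z‖ := norm_pos_iff.2 h0
  have := h (‖z‖⁻¹ • z) y (by rw [norm_smul, norm_inv, norm_norm, inv_mul_cancel₀ hz0.ne']) hy.le
  rw [← Matrix.inner_toEuclideanCLM, ← hz, real_inner_smul_left, real_inner_self_eq_norm_sq,
    sq, inv_mul_cancel_left₀ hz0.ne', abs_norm] at this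
  exact this

/-- The exponents are twice a power of two because the C*-identity, iterated, gives the norm of `M ^
2 ^ j` exactly for self-adjoint `M`. The trace is then the squared Frobenius norm of that power, and
no spectral decomposition is needed. -/
theorem opNorm_pow_le_trace {M : Matrix (Fin n) (Fin n) ℝ} (hM : M.IsSymm) (j : ℕ) :
    opNorm M ^ (2 * 2 ^ j) ≤ (M ^ (2 * 2 ^ j)).trace := by
  have hs : IsSelfAdjoint M := by
    rw [isSelfAdjoint_iff, Matrix.star_eq_conjTranspose, Matrix.conjTranspose_eq_transpose_of_trivial]
    exact hM
  rw [mul_comm 2, pow_mul, opNorm_eq_norm, ← hs.norm_pow_two_pow, ← opNorm_eq_norm]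
  refine (opNorm_sq_le_sum_sq _).trans_eq ?_
  have ht : (M ^ 2 ^ j).transpose = M ^ 2 ^ j := by rw [Matrix.transpose_pow, hM.eq]
  rw [pow_mul, sq (M ^ 2 ^ j)]
  simp only [Matrix.trace, Matrix.diag_apply, Matrix.mul_apply]
  refine Finset.sum_congr rfl fun a _ => Finset.sum_congr rfl fun b _ => ?_
  rw [sq]
  congr 1
  exact congrFun (congrFun ht.symm a) b

theorem trace_le_opNorm (M : Matrix (Fin n) (Fin n) ℝ) : M.trace ≤ n * opNorm M := by
  have : ∀ i, M i i ≤ opNorm M := fun i => by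
    have := abs_dotProduct_mulVec_le M (EuclideanSpace.single i 1) (EuclideanSpace.single i 1)
    simp at this
    exact (le_abs_self _).trans this
  calc M.trace ≤ ∑ _i : Fin n, opNorm M := Finset.sum_le_sum fun i _ => this i
    _ = _ := by simp

theorem trace_pow_le_opNorm_pow (M : Matrix (Fin n) (Fin n) ℝ) {l : ℕ} (hl : 0 < l) :
    (M ^ l).trace ≤ n * opNorm M ^ l := by
  refine (trace_le_opNorm _).trans ?_
  gcongr
  rw [opNorm_eq_norm, opNorm_eq_norm]
  exact norm_pow_le' M hl

theorem continuous_opNorm : Continuous (opNorm : Matrix (Fin n) (Fin n) ℝ → ℝ) := by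
  let T : Matrix (Fin n) (Fin n) ℝ →ₗ[ℝ] (EuclideanSpace ℝ (Fin n) →L[ℝ] EuclideanSpace ℝ (Fin n)) :=
    (Matrix.toEuclideanCLM (n := Fin n) (𝕜 := ℝ)).toAlgEquiv.toLinearMap
  exact continuous_norm.comp T.continuous_of_finiteDimensional

theorem measurable_opNorm : Measurable (opNorm : Matrix (Fin n) (Fin n) ℝ → ℝ) := by
  have : Measurable (fun M : Fin n → Fin n → ℝ => opNorm (Matrix.of M)) :=
    (continuous_opNorm.comp (continuous_id (X := Fin n → Fin n → ℝ))).measurable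
  exact this

end OpNorm

/-! ### Walks -/

section Walks

theorem pow_apply_eq_sum_walks {n : ℕ} (M : Matrix (Fin n) (Fin n) ℝ) (L : ℕ) (i j : Fin n) :
    (M ^ L) i j = ∑ w : Fin (L + 1) → Fin n,
      if w 0 = i ∧ w (Fin.last L) = j then ∏ t : Fin L, M (w t.castSucc) (w t.succ) else 0 := by
  induction L generalizing i with
  | zero =>
    rw [← (Equiv.funUnique (Fin 1) (Fin n)).symm.sum_comp]
    simp only [Matrix.one_apply, pow_zero]
    rw [Finset.sum_eq_single i]
    · simp
    · intro b _ hb; simp [hb]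
    · simp
  | succ L ih =>
    -- Peel off the first step of the walk; the induction hypothesis applies to the tail, whose
    -- starting point is free.
    rw [pow_succ', Matrix.mul_apply, ← (Fin.consEquiv fun _ : Fin (L + 2) => Fin n).sum_comp,
      Fintype.sum_prod_type]
    simp only [ih, Finset.mul_sum]
    rw [Finset.sum_comm, Finset.sum_comm (γ := Fin n)]
    refine Finset.sum_congr rfl fun w _ => ?_
    rw [Finset.sum_eq_single (w 0) (fun b _ hb => by simp [hb.symm]) (by simp),
      Finset.sum_eq_single i (fun b _ hb => by simp [Fin.consEquiv, hb]) (by simp)]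
    simp only [Fin.consEquiv, Equiv.coe_fn_mk, Fin.prod_univ_succ (n := L),
      Fin.cons_zero, Fin.castSucc_zero, ← Fin.succ_last, Fin.cons_succ, true_and,
      Fin.castSucc_succ, mul_ite, mul_zero]

theorem trace_pow_eq_sum_walks {n : ℕ} (M : Matrix (Fin n) (Fin n) ℝ) (L : ℕ) :
    (M ^ L).trace = ∑ w : Fin (L + 1) → Fin n,
      if w 0 = w (Fin.last L) then ∏ t : Fin L, M (w t.castSucc) (w t.succ) else 0 := by
  simp only [Matrix.trace, Matrix.diag_apply, pow_apply_eq_sum_walks]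
  rw [Finset.sum_comm]
  refine Finset.sum_congr rfl fun w _ => ?_
  rw [Finset.sum_eq_single (w 0)]
  · simp [eq_comm]
  · intro b _ hb; simp [hb.symm]
  · simp

variable {α β : Type*} {L : ℕ}

/-- The edge traversed by the walk `w` in step `t`. -/
def walkEdge (w : Fin (L + 1) → α) (t : Fin L) : Sym2 α := s(w t.castSucc, w t.succ)

/-- A closed walk without loops that traverses each of its edges at least twice. -/
structure IsRepeating (w : Fin (L + 1) → α) : Prop where
  closed : w 0 = w (Fin.last L)
  loopless : ∀ t : Fin L, w t.castSucc ≠ w t.succ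
  repeated : ∀ t : Fin L, ∃ u, u ≠ t ∧ walkEdge w u = walkEdge w t

/-- Being repeating depends only on which positions of the walk coincide, so walks can be counted
pattern by pattern, even across different vertex sets. -/
theorem IsRepeating.of_ker_eq {w : Fin (L + 1) → α} {v : Fin (L + 1) → β}
    (h : Setoid.ker w = Setoid.ker v) (hw : IsRepeating w) : IsRepeating v := by
  have key : ∀ i j, w i = w j ↔ v i = v j := fun i j => by
    rw [← Setoid.ker_def (f := w), ← Setoid.ker_def (f := v), h]
  refine ⟨(key _ _).1 hw.closed, fun t => (key _ _).not.1 (hw.loopless t), fun t => ?_⟩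
  obtain ⟨u, hu, he⟩ := hw.repeated t
  refine ⟨u, hu, ?_⟩
  simp only [walkEdge, Sym2.eq_iff, key] at he ⊢
  exact he

/-- The number of distinct edges of a walk. -/
def numEdges [DecidableEq α] (w : Fin (L + 1) → α) : ℕ := (Finset.univ.image (walkEdge w)).card

/-- The graph traced by a walk is connected. Inductively, a step to a vertex not seen before uses an
edge not seen before. -/
theorem card_image_le_numEdges_add_one [DecidableEq α] (w : Fin (L + 1) → α) :
    (Finset.univ.image w).card ≤ numEdges w + 1 := by
  classical
  induction L with
  | zero =>
    refine Finset.card_image_le.trans ?_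
    simp
  | succ L ih =>
    have h1 : Finset.univ.image w =
        insert (w (Fin.last _)) (Finset.univ.image fun i : Fin (L + 1) => w i.castSucc) := by
      ext x
      simp only [Finset.mem_image, Finset.mem_univ, true_and, Finset.mem_insert]
      rw [Fin.exists_fin_succ', or_comm, eq_comm (a := x)]
    have h2 : Finset.univ.image (walkEdge w) = insert (walkEdge w (Fin.last _))
        (Finset.univ.image (walkEdge fun i : Fin (L + 1) => w i.castSucc)) := by
      ext x
      simp only [Finset.mem_image, Finset.mem_univ, true_and, Finset.mem_insert]
      rw [Fin.exists_fin_succ', or_comm, eq_comm (a := x)]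
      rfl
    have := ih fun i => w i.castSucc
    rw [numEdges, h1, h2]
    by_cases hm : w (Fin.last _) ∈ Finset.univ.image fun i : Fin (L + 1) => w i.castSucc
    · rw [Finset.insert_eq_of_mem hm]
      exact this.trans (Nat.succ_le_succ (Finset.card_le_card (Finset.subset_insert _ _)))
    · rw [Finset.card_insert_of_notMem hm, Finset.card_insert_of_notMem]
      · exact Nat.succ_le_succ this
      · intro hmem
        apply hm
        simp only [Finset.mem_image, Finset.mem_univ, true_and] at hmem ⊢
        obtain ⟨t, ht⟩ := hmem
        have : w (Fin.last _) ∈ walkEdge w (Fin.last L) := by simp [walkEdge]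
        rw [← ht] at this
        simp only [walkEdge, Sym2.mem_iff] at this
        rcases this with h | h
        · exact ⟨_, h.symm⟩
        · exact ⟨_, h.symm⟩

theorem IsRepeating.two_mul_numEdges_le [DecidableEq α] {w : Fin (L + 1) → α} (hw : IsRepeating w) :
    2 * numEdges w ≤ L := by
  have h := Finset.card_eq_sum_card_image (walkEdge w) (Finset.univ : Finset (Fin L))
  rw [Finset.card_univ, Fintype.card_fin] at h
  refine le_of_le_of_eq ?_ h.symm
  rw [numEdges, mul_comm, ← smul_eq_mul]
  refine Finset.card_nsmul_le_sum _ _ _ fun e he => ?_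
  obtain ⟨t, -, rfl⟩ := Finset.mem_image.1 he
  obtain ⟨u, hu, hue⟩ := hw.repeated t
  exact Finset.one_lt_card.2 ⟨u, by simp [hue], t, by simp, hu⟩

/-- A walk with a given pattern is determined by its values on class representatives. -/
theorem card_ker_eq_le [Fintype α] (σ : Setoid (Fin (L + 1))) [Fintype (Quotient σ)]
    [DecidablePred fun w : Fin (L + 1) → α => Setoid.ker w = σ] :
    (Finset.univ.filter fun w : Fin (L + 1) → α => Setoid.ker w = σ).card ≤
      Fintype.card α ^ Fintype.card (Quotient σ) := by
  classical
  rw [← Fintype.card_fun, ← Finset.card_univ]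
  refine Finset.card_le_card_of_injOn (fun w q => w q.out) (fun _ _ => Finset.mem_coe.2 (Finset.mem_univ _)) ?_
  intro w hw v hv h
  simp only [Finset.coe_filter, Finset.mem_univ, true_and, Set.mem_ofPred_eq] at hw hv
  funext i
  have h1 : w (Quotient.mk σ i).out = w i := by
    rw [← Setoid.ker_def (f := w), hw]; exact Quotient.mk_out i
  have h2 : v (Quotient.mk σ i).out = v i := by
    rw [← Setoid.ker_def (f := v), hv]; exact Quotient.mk_out i
  rw [← h1, ← h2]
  exact congrFun h _

/-- Each injection of the set of classes into the vertex set induces a walk with exactly this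
pattern. -/
theorem descFactorial_le_card_ker_eq [Fintype α] (σ : Setoid (Fin (L + 1))) [Fintype (Quotient σ)]
    [DecidablePred fun w : Fin (L + 1) → α => Setoid.ker w = σ] :
    (Fintype.card α).descFactorial (Fintype.card (Quotient σ)) ≤
      (Finset.univ.filter fun w : Fin (L + 1) → α => Setoid.ker w = σ).card := by
  classical
  rw [← Fintype.card_embedding_eq, ← Finset.card_univ]
  refine Finset.card_le_card_of_injOn (fun g i => g (Quotient.mk σ i)) ?_ ?_
  · intro g _
    simp only [Finset.coe_filter, Finset.mem_univ, true_and, Set.mem_ofPred_eq]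
    ext i j
    rw [Setoid.ker_def, g.injective.eq_iff, Quotient.eq]
  · intro g _ g' _ h
    ext q
    induction q using Quotient.inductionOn with
    | h i => exact congrFun h i

theorem card_quotient_ker [DecidableEq α] (w : Fin (L + 1) → α) [Fintype (Quotient (Setoid.ker w))] :
    Fintype.card (Quotient (Setoid.ker w)) = (Finset.univ.image w).card := by
  classical
  rw [← Fintype.card_coe]
  refine Fintype.card_congr ((Setoid.quotientKerEquivRange w).trans (Equiv.subtypeEquivRight ?_))
  intro x; simp

open Classical in
/-- The comparison principle: the weighted number of repeating walks in a large vertex set is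
controlled by the number of repeating walks in a vertex set of size `n * p + m + 1`. -/
theorem sum_pow_numEdges_le {n r m : ℕ} {p : ℝ} (hp0 : 0 ≤ p) (hp1 : p ≤ 1)
    (hr : n * p + m + 1 ≤ r) :
    ∑ w : Fin (2 * m + 1) → Fin n with IsRepeating w, p ^ numEdges w ≤
      n * (Finset.univ.filter fun w : Fin (2 * m + 1) → Fin r => IsRepeating w).card := by
  have : Finite (Setoid (Fin (2 * m + 1))) :=
    Finite.of_injective (fun σ i j => σ.r i j) fun σ τ h =>
      Setoid.ext fun i j => iff_of_eq (congrFun (congrFun h i) j)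
  have : Fintype (Setoid (Fin (2 * m + 1))) := Fintype.ofFinite _
  rw [← Finset.sum_fiberwise _ (fun w => Setoid.ker w),
    Finset.card_eq_sum_card_fiberwise (f := fun w => Setoid.ker w) (t := Finset.univ)
      (fun _ _ => Finset.mem_coe.2 (Finset.mem_univ _))]
  push_cast
  rw [Finset.mul_sum]
  refine Finset.sum_le_sum fun σ _ => ?_
  rw [Finset.filter_filter, Finset.filter_filter]
  by_cases hσ : ∃ w : Fin (2 * m + 1) → Fin n, IsRepeating w ∧ Setoid.ker w = σ
  · obtain ⟨w₀, hw₀, hσ₀⟩ := hσ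
    have e2 : (Finset.univ.filter fun w : Fin (2 * m + 1) → Fin r =>
        IsRepeating w ∧ Setoid.ker w = σ) = Finset.univ.filter fun w => Setoid.ker w = σ := by
      refine Finset.filter_congr fun w _ => and_iff_right_of_imp fun h => ?_
      exact hw₀.of_ker_eq (hσ₀.trans h.symm)
    rw [e2]
    set V := Fintype.card (Quotient σ) with hV
    have hVw : ∀ {γ : Type} [DecidableEq γ] (w : Fin (2 * m + 1) → γ), Setoid.ker w = σ →
        (Finset.univ.image w).card = V := by
      intro γ _ w h
      subst h
      rw [hV]
      convert! (card_quotient_ker w).symm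
    have hV1 : 1 ≤ V := by
      rw [← hVw w₀ hσ₀]
      exact Finset.card_pos.2 (Finset.univ_nonempty.image _)
    have hVm : V ≤ m + 1 := by
      have h1 := card_image_le_numEdges_add_one w₀
      have h2 := hw₀.two_mul_numEdges_le
      rw [hVw w₀ hσ₀] at h1
      omega
    -- Every factor of the falling factorial is at least `r + 1 - V ≥ r - m ≥ n * p + 1`; this is
    -- where the size of `r` enters.
    have hD : ((n : ℝ) * p) ^ (V - 1) ≤ (r.descFactorial V : ℝ) := by
      have hrV : (1 : ℝ) ≤ ((r + 1 - V : ℕ) : ℝ) ∧ n * p ≤ ((r + 1 - V : ℕ) : ℝ) := by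
        have hnp : 0 ≤ (n : ℝ) * p := by positivity
        have : V ≤ r + 1 := by
          have : ((m + 1 : ℕ) : ℝ) ≤ r := by push_cast; linarith
          have := Nat.cast_le.1 this
          omega
        rw [Nat.cast_sub this]
        have : (V : ℝ) ≤ m + 1 := by exact_mod_cast hVm
        push_cast
        constructor <;> linarith
      calc ((n : ℝ) * p) ^ (V - 1) ≤ ((r + 1 - V : ℕ) : ℝ) ^ (V - 1) :=
            pow_le_pow_left₀ (by positivity) hrV.2 _
        _ ≤ ((r + 1 - V : ℕ) : ℝ) ^ V := pow_le_pow_right₀ hrV.1 (Nat.sub_le _ _)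
        _ ≤ _ := by exact_mod_cast Nat.pow_sub_le_descFactorial r V
    have hcr : (r.descFactorial V : ℝ) ≤
        ((Finset.univ.filter fun w : Fin (2 * m + 1) → Fin r => Setoid.ker w = σ).card : ℝ) := by
      have := descFactorial_le_card_ker_eq (α := Fin r) σ
      rw [Fintype.card_fin] at this
      exact_mod_cast this
    have hcn : ((Finset.univ.filter fun w : Fin (2 * m + 1) → Fin n =>
        IsRepeating w ∧ Setoid.ker w = σ).card : ℝ) ≤ (n : ℝ) ^ V := by
      have := card_ker_eq_le (α := Fin n) σ
      rw [Fintype.card_fin] at this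
      refine le_trans ?_ (Nat.cast_le (α := ℝ).2 this |>.trans_eq (Nat.cast_pow _ _))
      exact Nat.cast_le.2 (Finset.card_le_card fun w => by simp +contextual)
    calc ∑ w : Fin (2 * m + 1) → Fin n with IsRepeating w ∧ Setoid.ker w = σ, p ^ numEdges w
        ≤ ∑ w : Fin (2 * m + 1) → Fin n with IsRepeating w ∧ Setoid.ker w = σ, p ^ (V - 1) := by
          refine Finset.sum_le_sum fun w hw => pow_le_pow_of_le_one hp0 hp1 ?_
          have := card_image_le_numEdges_add_one w
          rw [hVw w (Finset.mem_filter.1 hw).2.2] at this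
          omega
      _ ≤ (n : ℝ) ^ V * p ^ (V - 1) := by
          rw [Finset.sum_const, nsmul_eq_mul]
          gcongr
      -- A pattern has one vertex more than the edges guaranteed by connectedness; this surplus is
      -- the prefactor `n`.
      _ = n * (n * p) ^ (V - 1) := by
          obtain ⟨U, hU⟩ : ∃ U, V = U + 1 := ⟨V - 1, by omega⟩
          rw [hU, Nat.add_sub_cancel, mul_pow]; ring
      _ ≤ _ := by gcongr; exact hD.trans hcr
  · have : (Finset.univ.filter fun w : Fin (2 * m + 1) → Fin n =>
        IsRepeating w ∧ Setoid.ker w = σ) = ∅ := by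
      refine Finset.filter_eq_empty_iff.2 fun w _ h => hσ ⟨w, h⟩
    rw [this, Finset.sum_empty]
    positivity

end Walks

/-! ### Trace moments of random symmetric matrices -/

section Moments

variable {n : ℕ}

/-- The symmetric matrix with zero diagonal and the given entries above the diagonal. -/
noncomputable def symmetrize (x : Pairs n → ℝ) : Matrix (Fin n) (Fin n) ℝ :=
  Matrix.of fun i j => if h : i < j then x ⟨(i, j), h⟩ else if h : j < i then x ⟨(j, i), h⟩ else 0

/-- The unordered pair of two distinct nodes. -/
def pairOf {i j : Fin n} (h : i ≠ j) : Pairs n :=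
  if hl : i < j then ⟨(i, j), hl⟩ else ⟨(j, i), lt_of_le_of_ne (not_lt.1 hl) h.symm⟩

theorem symmetrize_apply_self (x : Pairs n → ℝ) (i : Fin n) : symmetrize x i i = 0 := by
  simp [symmetrize]

theorem symmetrize_apply (x : Pairs n → ℝ) {i j : Fin n} (h : i ≠ j) :
    symmetrize x i j = x (pairOf h) := by
  rcases lt_or_gt_of_ne h with hl | hl
  · simp [symmetrize, pairOf, hl]
  · simp [symmetrize, pairOf, hl, hl.not_gt]

theorem pairOf_symm {i j : Fin n} (h : i ≠ j) : pairOf h.symm = pairOf h := by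
  rcases lt_or_gt_of_ne h with hl | hl
  · simp [pairOf, hl, hl.not_gt]
  · simp [pairOf, hl, hl.not_gt]

theorem isSymm_symmetrize (x : Pairs n → ℝ) : (symmetrize x).IsSymm := by
  refine Matrix.IsSymm.ext fun i j => ?_
  rcases eq_or_ne i j with rfl | h
  · rfl
  · rw [symmetrize_apply x h, symmetrize_apply x h.symm, pairOf_symm]

theorem injective_pairs_sym2 : Function.Injective fun e : Pairs n => s(e.1.1, e.1.2) := by
  rintro ⟨⟨a, b⟩, hab⟩ ⟨⟨c, d⟩, hcd⟩ h
  simp only [Sym2.eq_iff] at h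
  rcases h with ⟨rfl, rfl⟩ | ⟨rfl, rfl⟩
  · rfl
  · exact absurd hab (not_lt.2 (le_of_lt hcd))

theorem sym2_pairOf {i j : Fin n} (h : i ≠ j) :
    s((pairOf h).1.1, (pairOf h).1.2) = s(i, j) := by
  unfold pairOf
  split_ifs
  · rfl
  · exact Sym2.eq_swap

theorem pairOf_eq_iff {i j k l : Fin n} (h : i ≠ j) (h' : k ≠ l) :
    pairOf h = pairOf h' ↔ s(i, j) = s(k, l) := by
  rw [← injective_pairs_sym2.eq_iff, sym2_pairOf, sym2_pairOf]

variable {L : ℕ}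

theorem prod_symmetrize_walk (x : Pairs n → ℝ) {w : Fin (L + 1) → Fin n}
    (hw : ∀ t : Fin L, w t.castSucc ≠ w t.succ) :
    ∏ t : Fin L, symmetrize x (w t.castSucc) (w t.succ) =
      ∏ e, x e ^ (Finset.univ.filter fun t => pairOf (hw t) = e).card := by
  simp only [fun t => symmetrize_apply x (hw t)]
  rw [← Finset.prod_fiberwise (s := Finset.univ) (g := fun t => pairOf (hw t))]
  refine Finset.prod_congr rfl fun e _ => ?_
  rw [Finset.prod_congr rfl (g := fun _ => x e) (fun t ht => by rw [(Finset.mem_filter.1 ht).2]),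
    Finset.prod_const]

theorem prod_symmetrize_walk_eq_zero (x : Pairs n → ℝ) {w : Fin (L + 1) → Fin n}
    (hw : ¬ ∀ t : Fin L, w t.castSucc ≠ w t.succ) :
    ∏ t : Fin L, symmetrize x (w t.castSucc) (w t.succ) = 0 := by
  push Not at hw
  obtain ⟨t, ht⟩ := hw
  exact Finset.prod_eq_zero (Finset.mem_univ t) (by rw [ht, symmetrize_apply_self])

theorem card_image_pairOf {w : Fin (L + 1) → Fin n}
    (hw : ∀ t : Fin L, w t.castSucc ≠ w t.succ) :
    (Finset.univ.image fun t => pairOf (hw t)).card = numEdges w := by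
  rw [numEdges, ← Finset.card_image_of_injective _ injective_pairs_sym2, Finset.image_image]
  congr 2
  funext t
  exact sym2_pairOf _

variable {X : Type*} [MeasurableSpace X] {μ : Pairs n → Measure X}
  [∀ e, IsProbabilityMeasure (μ e)] {f : Pairs n → X → ℝ}

/-- By independence the expectation factors over pairs, each with the moment whose order is the
number of traversals. -/
theorem integral_walk {w : Fin (L + 1) → Fin n} (hw : ∀ t : Fin L, w t.castSucc ≠ w t.succ) :
    ∫ ω, ∏ t : Fin L, symmetrize (fun e => f e (ω e)) (w t.castSucc) (w t.succ) ∂Measure.pi μ =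
      ∏ e, ∫ x, f e x ^ (Finset.univ.filter fun t => pairOf (hw t) = e).card ∂μ e := by
  simp only [prod_symmetrize_walk _ hw]
  exact integral_fintype_prod_eq_prod
    (fun e x => f e x ^ (Finset.univ.filter fun t => pairOf (hw t) = e).card)

theorem integrable_walk (hf : ∀ e (j : ℕ), Integrable (fun x => f e x ^ j) (μ e))
    (w : Fin (L + 1) → Fin n) :
    Integrable (fun ω => ∏ t : Fin L, symmetrize (fun e => f e (ω e)) (w t.castSucc) (w t.succ))
      (Measure.pi μ) := by
  by_cases hw : ∀ t : Fin L, w t.castSucc ≠ w t.succ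
  · simp only [prod_symmetrize_walk _ hw]
    exact Integrable.fintype_prod_dep
      (f := fun e x => f e x ^ (Finset.univ.filter fun t => pairOf (hw t) = e).card)
      fun e => hf e _
  · simp only [prod_symmetrize_walk_eq_zero _ hw]
    exact integrable_zero _ _ _

theorem integrable_trace_pow (hf : ∀ e (j : ℕ), Integrable (fun x => f e x ^ j) (μ e)) (L : ℕ) :
    Integrable (fun ω => (symmetrize (fun e => f e (ω e)) ^ L).trace) (Measure.pi μ) := by
  simp only [trace_pow_eq_sum_walks]
  refine integrable_finsetSum _ fun w _ => ?_
  split_ifs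
  · exact integrable_walk hf w
  · exact integrable_zero _ _ _

/-- In a loopless walk that is not repeating, some edge is traversed exactly once and contributes
its mean, which is `0`; a loop hits the zero diagonal. -/
theorem integral_walk_eq_zero (hf0 : ∀ e, ∫ x, f e x ∂μ e = 0) {w : Fin (L + 1) → Fin n}
    (hc : w 0 = w (Fin.last L)) (hw : ¬ IsRepeating w) :
    ∫ ω, ∏ t : Fin L, symmetrize (fun e => f e (ω e)) (w t.castSucc) (w t.succ)
      ∂Measure.pi μ = 0 := by
  by_cases hl : ∀ t : Fin L, w t.castSucc ≠ w t.succ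
  · obtain ⟨t, ht⟩ : ∃ t, ∀ u, u ≠ t → walkEdge w u ≠ walkEdge w t := by
      by_contra! h
      exact hw ⟨hc, hl, h⟩
    rw [integral_walk hl]
    refine Finset.prod_eq_zero (Finset.mem_univ (pairOf (hl t))) ?_
    have : (Finset.univ.filter fun u => pairOf (hl u) = pairOf (hl t)) = {t} := by
      ext u
      simp only [Finset.mem_filter, Finset.mem_univ, true_and, Finset.mem_singleton, pairOf_eq_iff]
      exact ⟨fun h => by_contra fun hu => ht u hu h, fun h => by rw [h]⟩
    rw [this]
    simpa using hf0 _
  · simp only [prod_symmetrize_walk_eq_zero _ hl, integral_zero]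

open Classical in
theorem integral_trace_pow (hf : ∀ e (j : ℕ), Integrable (fun x => f e x ^ j) (μ e))
    (hf0 : ∀ e, ∫ x, f e x ∂μ e = 0) (L : ℕ) :
    ∫ ω, (symmetrize (fun e => f e (ω e)) ^ L).trace ∂Measure.pi μ =
      ∑ w : Fin (L + 1) → Fin n with IsRepeating w,
        ∫ ω, ∏ t : Fin L, symmetrize (fun e => f e (ω e)) (w t.castSucc) (w t.succ)
          ∂Measure.pi μ := by
  simp only [trace_pow_eq_sum_walks]
  rw [integral_finsetSum, Finset.sum_filter]
  · refine Finset.sum_congr rfl fun w _ => ?_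
    by_cases hc : w 0 = w (Fin.last L)
    · simp only [hc, if_true]
      split_ifs with h
      · rfl
      · exact integral_walk_eq_zero hf0 hc h
    · rw [if_neg fun h => hc h.closed]
      simp only [hc, if_false, integral_zero]
  · intro w _
    split_ifs
    · exact integrable_walk hf w
    · exact integrable_zero _ _ _

theorem IsRepeating.card_filter_pairOf {w : Fin (L + 1) → Fin n} (hw : IsRepeating w)
    {e : Pairs n} (he : e ∈ Finset.univ.image fun t => pairOf (hw.loopless t)) :
    2 ≤ (Finset.univ.filter fun t => pairOf (hw.loopless t) = e).card := by
  obtain ⟨t, -, rfl⟩ := Finset.mem_image.1 he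
  obtain ⟨u, hu, hue⟩ := hw.repeated t
  exact Finset.one_lt_card.2 ⟨u, Finset.mem_filter.2
    ⟨Finset.mem_univ _, (pairOf_eq_iff _ _).2 hue⟩, t, by simp, hu⟩

theorem card_filter_pairOf_eq_zero {w : Fin (L + 1) → Fin n}
    (hw : ∀ t : Fin L, w t.castSucc ≠ w t.succ)
    {e : Pairs n} (he : e ∉ Finset.univ.image fun t => pairOf (hw t)) :
    (Finset.univ.filter fun t => pairOf (hw t) = e).card = 0 := by
  rw [Finset.card_eq_zero, Finset.filter_eq_empty_iff]
  exact fun t _ h => he (Finset.mem_image.2 ⟨t, Finset.mem_univ _, h⟩)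

/-- Each visited edge carries a moment of order at least two, hence at most `p`; unvisited pairs
contribute the factor `1`. -/
theorem IsRepeating.integral_walk_le {p : ℝ}
    (hfp : ∀ e (j : ℕ), 2 ≤ j → |∫ x, f e x ^ j ∂μ e| ≤ p)
    {w : Fin (L + 1) → Fin n} (hw : IsRepeating w) :
    ∫ ω, ∏ t : Fin L, symmetrize (fun e => f e (ω e)) (w t.castSucc) (w t.succ)
      ∂Measure.pi μ ≤ p ^ numEdges w := by
  rw [integral_walk hw.loopless, ← card_image_pairOf hw.loopless]
  refine (le_abs_self _).trans ?_
  rw [Finset.abs_prod, ← Finset.prod_const,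
    ← Finset.prod_subset (Finset.subset_univ (Finset.univ.image fun t => pairOf (hw.loopless t)))]
  · exact Finset.prod_le_prod (fun _ _ => abs_nonneg _)
      fun e he => hfp e _ (hw.card_filter_pairOf he)
  · intro e _ he
    rw [card_filter_pairOf_eq_zero hw.loopless he]
    simp

theorem IsRepeating.one_le_integral_walk
    (hfp : ∀ e (j : ℕ), 2 ≤ j → 1 ≤ ∫ x, f e x ^ j ∂μ e)
    {w : Fin (L + 1) → Fin n} (hw : IsRepeating w) :
    1 ≤ ∫ ω, ∏ t : Fin L, symmetrize (fun e => f e (ω e)) (w t.castSucc) (w t.succ)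
      ∂Measure.pi μ := by
  rw [integral_walk hw.loopless]
  rw [← Finset.prod_const_one (s := (Finset.univ : Finset (Pairs n)))]
  refine Finset.prod_le_prod (fun _ _ => zero_le_one) fun e _ => ?_
  by_cases he : e ∈ Finset.univ.image fun t => pairOf (hw.loopless t)
  · exact hfp e _ (hw.card_filter_pairOf he)
  · rw [card_filter_pairOf_eq_zero hw.loopless he]
    simp

/-- Comparison of the trace moment of a sparse random symmetric matrix with that of a dense random
symmetric matrix of much smaller size. -/
theorem integral_trace_pow_le {r m : ℕ} {p : ℝ} (hp0 : 0 ≤ p) (hp1 : p ≤ 1)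
    (hr : n * p + m + 1 ≤ r)
    (hf : ∀ e (j : ℕ), Integrable (fun x => f e x ^ j) (μ e))
    (hf0 : ∀ e, ∫ x, f e x ∂μ e = 0)
    (hfp : ∀ e (j : ℕ), 2 ≤ j → |∫ x, f e x ^ j ∂μ e| ≤ p)
    {Y : Type*} [MeasurableSpace Y] {ν : Pairs r → Measure Y}
    [∀ e, IsProbabilityMeasure (ν e)] {g : Pairs r → Y → ℝ}
    (hg : ∀ e (j : ℕ), Integrable (fun x => g e x ^ j) (ν e))
    (hg0 : ∀ e, ∫ x, g e x ∂ν e = 0)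
    (hg1 : ∀ e (j : ℕ), 2 ≤ j → 1 ≤ ∫ x, g e x ^ j ∂ν e) :
    ∫ ω, (symmetrize (fun e => f e (ω e)) ^ (2 * m)).trace ∂Measure.pi μ ≤
      n * ∫ ω, (symmetrize (fun e => g e (ω e)) ^ (2 * m)).trace ∂Measure.pi ν := by
  classical
  rw [integral_trace_pow hf hf0, integral_trace_pow hg hg0]
  calc _ ≤ ∑ w : Fin (2 * m + 1) → Fin n with IsRepeating w, p ^ numEdges w :=
        Finset.sum_le_sum fun w hw => (Finset.mem_filter.1 hw).2.integral_walk_le hfp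
    _ ≤ n * (Finset.univ.filter fun w : Fin (2 * m + 1) → Fin r => IsRepeating w).card :=
        sum_pow_numEdges_le hp0 hp1 hr
    _ ≤ _ := by
        gcongr
        rw [Finset.card_eq_sum_ones]
        push_cast
        exact Finset.sum_le_sum fun w hw => (Finset.mem_filter.1 hw).2.one_le_integral_walk hg1

end Moments

/-! ### A lattice net for the unit ball -/

section Net

/-- Integer vectors of squared length at most `16 * r`; scaled by `1 / (4 * √r)` they form a net of
the unit ball. -/
noncomputable def latticeNet (r : ℕ) : Finset (Fin r → ℤ) :=
  (Fintype.piFinset fun _ => Finset.Icc (-(16 * r : ℤ)) (16 * r)).filter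
    fun z => ∑ i, z i ^ 2 ≤ 16 * r

theorem mem_latticeNet {r : ℕ} {z : Fin r → ℤ} : z ∈ latticeNet r ↔ ∑ i, z i ^ 2 ≤ 16 * r := by
  simp only [latticeNet, Finset.mem_filter, Fintype.mem_piFinset, Finset.mem_Icc,
    and_iff_right_iff_imp]
  intro h i
  have h1 : z i ^ 2 ≤ 16 * r :=
    (Finset.single_le_sum (f := fun i => z i ^ 2) (fun _ _ => sq_nonneg _) (Finset.mem_univ i)).trans h
  have h2 : |z i| ≤ z i ^ 2 := Int.natCast_natAbs (z i) ▸ Int.natAbs_le_self_sq (z i)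
  exact abs_le.1 (h2.trans h1)

theorem sum_Icc_half_pow_natAbs_le (N : ℕ) :
    ∑ a ∈ Finset.Icc (-(N : ℤ)) N, (1 / 2 : ℝ) ^ a.natAbs ≤ 3 - 2 * (1 / 2) ^ N := by
  induction N with
  | zero => norm_num
  | succ N ih =>
    have : Finset.Icc (-((N + 1 : ℕ) : ℤ)) ((N + 1 : ℕ) : ℤ) =
        insert (-((N + 1 : ℕ) : ℤ)) (insert ((N + 1 : ℕ) : ℤ) (Finset.Icc (-(N : ℤ)) N)) := by
      ext a
      simp only [Finset.mem_Icc, Finset.mem_insert]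
      omega
    rw [this, Finset.sum_insert, Finset.sum_insert]
    · rw [Int.natAbs_neg, Int.natAbs_natCast]
      calc _ ≤ (1 / 2 : ℝ) ^ (N + 1) + ((1 / 2 : ℝ) ^ (N + 1) + (3 - 2 * (1 / 2) ^ N)) := by
            gcongr
        _ = 3 - 2 * (1 / 2) ^ (N + 1) := by ring
    · simp
    · simp only [Finset.mem_insert, Finset.mem_Icc]
      omega

/-- Weight `z` by `2 ^ (-∑ |z i|)`. Since `|z i| ≤ z i ^ 2`, each net point has weight at least `2 ^
(-16 * r)`, while the total weight over the box factors into one-dimensional sums, each at most `3`.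
-/
theorem card_latticeNet_le (r : ℕ) : ((latticeNet r).card : ℝ) ≤ (3 * 2 ^ 16) ^ r := by
  have h1 : ((latticeNet r).card : ℝ) * (1 / 2) ^ (16 * r) ≤ 3 ^ r := by
    calc ((latticeNet r).card : ℝ) * (1 / 2) ^ (16 * r)
        = ∑ _z ∈ latticeNet r, (1 / 2 : ℝ) ^ (16 * r) := by
          rw [Finset.sum_const, nsmul_eq_mul]
      _ ≤ ∑ z ∈ latticeNet r, ∏ i, (1 / 2 : ℝ) ^ (z i).natAbs := by
          refine Finset.sum_le_sum fun z hz => ?_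
          rw [Finset.prod_pow_eq_pow_sum]
          refine pow_le_pow_of_le_one (by norm_num) (by norm_num) ?_
          have h := mem_latticeNet.1 hz
          zify
          refine le_trans (Finset.sum_le_sum fun i _ => ?_) h
          exact Int.natCast_natAbs (z i) ▸ Int.natAbs_le_self_sq (z i)
      _ ≤ ∑ z ∈ Fintype.piFinset fun _ : Fin r => Finset.Icc (-((16 * r : ℕ) : ℤ)) ((16 * r : ℕ) : ℤ),
            ∏ i, (1 / 2 : ℝ) ^ (z i).natAbs := by
          refine Finset.sum_le_sum_of_subset_of_nonneg ?_ fun _ _ _ => by positivity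
          push_cast
          exact Finset.filter_subset _ _
      _ = ∏ _i : Fin r, ∑ a ∈ Finset.Icc (-((16 * r : ℕ) : ℤ)) ((16 * r : ℕ) : ℤ),
            (1 / 2 : ℝ) ^ a.natAbs := by
          rw [Finset.prod_univ_sum]
      _ ≤ ∏ _i : Fin r, (3 : ℝ) := by
          refine Finset.prod_le_prod (fun _ _ => by positivity) fun _ _ => ?_
          refine (sum_Icc_half_pow_natAbs_le _).trans ?_
          have : (0 : ℝ) ≤ 2 * (1 / 2) ^ (16 * r) := by positivity
          linarith
      _ = 3 ^ r := by simp
  rw [one_div, inv_pow, ← div_eq_mul_inv, div_le_iff₀ (by positivity)] at h1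
  rwa [mul_pow, ← pow_mul]

/-- Rounding towards zero keeps the rounded vector inside the ball. -/
theorem exists_int_abs_le (a : ℝ) : ∃ z : ℤ, |(z : ℝ)| ≤ |a| ∧ |a - z| ≤ 1 := by
  rcases le_total 0 a with h | h
  · refine ⟨⌊a⌋, ?_, ?_⟩
    · rw [abs_of_nonneg h, abs_of_nonneg (by exact_mod_cast Int.floor_nonneg.2 h)]
      exact Int.floor_le a
    · rw [abs_le]; constructor <;> linarith [Int.floor_le a, Int.lt_floor_add_one a]
  · refine ⟨⌈a⌉, ?_, ?_⟩
    · rw [abs_of_nonpos h, abs_of_nonpos (by exact_mod_cast Int.ceil_le.2 (by simpa using h))]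
      linarith [Int.le_ceil a]
    · rw [abs_le]; constructor <;> linarith [Int.le_ceil a, Int.ceil_lt_add_one a]

/-- The point of the unit ball of `ℝ ^ r` given by an integer vector. -/
noncomputable def latticePoint {r : ℕ} (z : Fin r → ℤ) : EuclideanSpace ℝ (Fin r) :=
  WithLp.toLp 2 fun i => (4 * Real.sqrt r)⁻¹ * (z i : ℝ)

theorem norm_latticePoint_le {r : ℕ} (hr : 0 < r) {z : Fin r → ℤ} (hz : z ∈ latticeNet r) :
    ‖latticePoint z‖ ≤ 1 := by
  have hr' : (0 : ℝ) < r := by exact_mod_cast hr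
  rw [← sq_le_one_iff₀ (norm_nonneg _), EuclideanSpace.real_norm_sq_eq]
  simp only [latticePoint, mul_pow, inv_pow, Real.sq_sqrt hr'.le]
  rw [← Finset.mul_sum, inv_mul_le_iff₀ (by positivity)]
  have h : ((∑ i, z i ^ 2 : ℤ) : ℝ) ≤ ((16 * r : ℤ) : ℝ) := Int.cast_le.2 (mem_latticeNet.1 hz)
  push_cast at h
  linarith

theorem exists_latticePoint_near {r : ℕ} (hr : 0 < r) {x : EuclideanSpace ℝ (Fin r)}
    (hx : ‖x‖ ≤ 1) : ∃ z ∈ latticeNet r, ‖x - latticePoint z‖ ≤ 1 / 4 := by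
  have hr' : (0 : ℝ) < r := by exact_mod_cast hr
  have hs : 0 < Real.sqrt r := Real.sqrt_pos.2 hr'
  choose z hz1 hz2 using fun i => exists_int_abs_le (4 * Real.sqrt r * x i)
  refine ⟨z, ?_, ?_⟩
  · rw [mem_latticeNet]
    have : (∑ i, (z i : ℝ) ^ 2) ≤ 16 * r := by
      calc ∑ i, (z i : ℝ) ^ 2 ≤ ∑ i, (4 * Real.sqrt r * x i) ^ 2 :=
            Finset.sum_le_sum fun i _ => sq_le_sq.2 (hz1 i)
        _ = 16 * r * ‖x‖ ^ 2 := by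
            rw [EuclideanSpace.real_norm_sq_eq, Finset.mul_sum]
            refine Finset.sum_congr rfl fun i _ => ?_
            rw [mul_pow, mul_pow, Real.sq_sqrt hr'.le]; ring
        _ ≤ 16 * r * 1 := by
            gcongr; exact pow_le_one₀ (norm_nonneg _) hx
        _ = _ := mul_one _
    exact_mod_cast this
  · rw [← abs_of_nonneg (norm_nonneg (x - _)), ← sq_le_sq₀ (abs_nonneg _) (by norm_num), sq_abs,
      EuclideanSpace.real_norm_sq_eq]
    calc ∑ i, (x - latticePoint z) i ^ 2 ≤ ∑ _i : Fin r, (16 * r : ℝ)⁻¹ := by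
          refine Finset.sum_le_sum fun i _ => ?_
          have : (x - latticePoint z) i = (4 * Real.sqrt r)⁻¹ * (4 * Real.sqrt r * x i - z i) := by
            simp only [latticePoint, PiLp.sub_apply]
            field_simp
          rw [this, mul_pow, inv_pow, mul_pow, Real.sq_sqrt hr'.le]
          have h1 : (4 * Real.sqrt r * x i - z i) ^ 2 ≤ 1 := (sq_le_one_iff_abs_le_one _).2 (hz2 i)
          calc ((4 : ℝ) ^ 2 * r)⁻¹ * _ ≤ ((4 : ℝ) ^ 2 * r)⁻¹ * 1 := by gcongr
            _ = _ := by norm_num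
      _ = (1 / 4) ^ 2 := by
          rw [Finset.sum_const, Finset.card_univ, Fintype.card_fin, nsmul_eq_mul]
          field_simp
          norm_num

theorem exists_opNorm_le_latticePoint {r : ℕ} (hr : 0 < r) (M : Matrix (Fin r) (Fin r) ℝ) :
    ∃ y ∈ latticeNet r, ∃ z ∈ latticeNet r, opNorm M ≤
      2 * |(latticePoint y).ofLp ⬝ᵥ M.mulVec (latticePoint z).ofLp| := by
  have h0 : (latticeNet r ×ˢ latticeNet r).Nonempty :=
    ⟨(0, 0), by simp [mem_latticeNet]⟩
  obtain ⟨⟨y, z⟩, hyz, hmax⟩ := Finset.exists_max_image _ (fun u : (Fin r → ℤ) × (Fin r → ℤ) =>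
    |(latticePoint u.1).ofLp ⬝ᵥ M.mulVec (latticePoint u.2).ofLp|) h0
  rw [Finset.mem_product] at hyz
  refine ⟨y, hyz.1, z, hyz.2, ?_⟩
  have hN := opNorm_nonneg M
  -- Replacing each of the two test vectors by a net point within `1 / 4` costs at most a quarter of
  -- the norm; the resulting half is absorbed on the left.
  suffices opNorm M ≤ opNorm M / 2 +
      |(latticePoint y).ofLp ⬝ᵥ M.mulVec (latticePoint z).ofLp| by linarith
  refine opNorm_le_of_dotProduct_le (by positivity) fun a b ha hb => ?_
  obtain ⟨u, hu, hau⟩ := exists_latticePoint_near hr ha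
  obtain ⟨v, hv, hbv⟩ := exists_latticePoint_near hr hb
  have e : a.ofLp ⬝ᵥ M.mulVec b.ofLp =
      (a - latticePoint u).ofLp ⬝ᵥ M.mulVec b.ofLp +
      (latticePoint u).ofLp ⬝ᵥ M.mulVec (b - latticePoint v).ofLp +
      (latticePoint u).ofLp ⬝ᵥ M.mulVec (latticePoint v).ofLp := by
    simp only [WithLp.ofLp_sub, sub_dotProduct, Matrix.mulVec_sub, dotProduct_sub]
    ring
  have h1 := abs_dotProduct_mulVec_le M (a - latticePoint u) b
  have h2 := abs_dotProduct_mulVec_le M (latticePoint u) (b - latticePoint v)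
  have h3 := hmax (u, v) (Finset.mem_product.2 ⟨hu, hv⟩)
  have h1' : opNorm M * ‖a - latticePoint u‖ * ‖b‖ ≤ opNorm M * (1 / 4) * 1 := by gcongr
  have h2' : opNorm M * ‖latticePoint u‖ * ‖b - latticePoint v‖ ≤ opNorm M * 1 * (1 / 4) := by
    gcongr
    exact norm_latticePoint_le hr hu
  rw [e]
  refine (abs_add_three _ _ _).trans ?_
  simp only at h3
  linarith

end Net

/-! ### Norm moments of a dense comparison matrix -/

section Comparison

theorem sum_sum_eq_sum_pairs {n : ℕ} (F : Fin n → Fin n → ℝ) (hF : ∀ i, F i i = 0) :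
    ∑ i, ∑ j, F i j = ∑ e : Pairs n, (F e.1.1 e.1.2 + F e.1.2 e.1.1) := by
  have h : ∀ G : Fin n → Fin n → ℝ, ∑ i, ∑ j, (if i < j then G i j else 0) =
      ∑ e : Pairs n, G e.1.1 e.1.2 := by
    intro G
    rw [← Fintype.sum_prod_type', ← Finset.sum_filter]
    exact Finset.sum_subtype _ (fun x => by simp) fun x : Fin n × Fin n => G x.1 x.2
  rw [Finset.sum_add_distrib, ← h F, ← h fun i j => F j i,
    Finset.sum_comm (f := fun i j => if i < j then F j i else 0), ← Finset.sum_add_distrib]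
  refine Finset.sum_congr rfl fun i _ => ?_
  rw [← Finset.sum_add_distrib]
  refine Finset.sum_congr rfl fun j _ => ?_
  rcases lt_trichotomy i j with hij | rfl | hij
  · simp [hij, hij.not_gt]
  · simp [hF]
  · simp [hij, hij.not_gt]

theorem dotProduct_symmetrize_mulVec {n : ℕ} (y : Pairs n → ℝ) (x z : Fin n → ℝ) :
    x ⬝ᵥ (symmetrize y).mulVec z =
      ∑ e, y e * (x e.1.1 * z e.1.2 + x e.1.2 * z e.1.1) := by
  simp only [dotProduct, Matrix.mulVec, Finset.mul_sum]
  rw [sum_sum_eq_sum_pairs _ fun i => by rw [symmetrize_apply_self]; ring]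
  refine Finset.sum_congr rfl fun e _ => ?_
  simp only [symmetrize, Matrix.of_apply, e.2, e.2.not_gt, dif_pos, dif_neg, not_false_eq_true]
  ring

theorem sum_sq_coeff_le {n : ℕ} (x z : Fin n → ℝ) :
    ∑ e : Pairs n, (x e.1.1 * z e.1.2 + x e.1.2 * z e.1.1) ^ 2 ≤
      2 * ((∑ i, x i ^ 2) * ∑ i, z i ^ 2) := by
  have h := sum_sum_eq_sum_pairs (fun i j => if i = j then 0 else x i ^ 2 * z j ^ 2) (by simp)
  calc ∑ e : Pairs n, (x e.1.1 * z e.1.2 + x e.1.2 * z e.1.1) ^ 2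
      ≤ ∑ e : Pairs n, 2 * ((if e.1.1 = e.1.2 then 0 else x e.1.1 ^ 2 * z e.1.2 ^ 2) +
          (if e.1.2 = e.1.1 then 0 else x e.1.2 ^ 2 * z e.1.1 ^ 2)) := by
        refine Finset.sum_le_sum fun e _ => ?_
        rw [if_neg e.2.ne, if_neg e.2.ne']
        nlinarith [sq_nonneg (x e.1.1 * z e.1.2 - x e.1.2 * z e.1.1)]
    _ = 2 * ∑ i, ∑ j, (if i = j then 0 else x i ^ 2 * z j ^ 2) := by
        rw [← Finset.mul_sum, h]
    _ ≤ 2 * ∑ i, ∑ j, x i ^ 2 * z j ^ 2 := by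
        gcongr with i _ j _
        split_ifs
        · positivity
        · exact le_rfl
    _ = _ := by rw [Finset.sum_mul_sum]

/-- The centered two-point distribution with values `2` and `-1`, all of whose moments of order at
least `2` are at least `1`. -/
noncomputable def comparisonMeasure : Measure ℝ :=
  bernoulliMeasure 2 (-1) ⟨1 / 3, by norm_num, by norm_num⟩

instance : IsProbabilityMeasure comparisonMeasure := by
  unfold comparisonMeasure; infer_instance

theorem integral_comparisonMeasure (f : ℝ → ℝ) :
    ∫ y, f y ∂comparisonMeasure = 1 / 3 * f 2 + 2 / 3 * f (-1) := by
  rw [comparisonMeasure, integral_bernoulliMeasure]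
  simp only [smul_eq_mul]
  norm_num

theorem integrable_comparisonMeasure (f : ℝ → ℝ) : Integrable f comparisonMeasure :=
  integrable_bernoulliMeasure _ _ _ _

/-- Random signs would not serve, as their odd moments vanish and a repeating walk may use an edge
three times. Here even moments are at least `4/3 + 2/3` and odd ones at least `8/3 - 2/3`. -/
theorem one_le_integral_pow_comparisonMeasure {j : ℕ} (hj : 2 ≤ j) :
    1 ≤ ∫ y, y ^ j ∂comparisonMeasure := by
  rw [integral_comparisonMeasure]
  rcases Nat.even_or_odd j with h | h
  · rw [h.neg_one_pow]
    have : (2 : ℝ) ^ 2 ≤ 2 ^ j := pow_le_pow_right₀ (by norm_num) hj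
    linarith
  · rw [h.neg_one_pow]
    have h3 : 3 ≤ j := by
      rcases h with ⟨a, rfl⟩; omega
    have : (2 : ℝ) ^ 3 ≤ 2 ^ j := pow_le_pow_right₀ (by norm_num) h3
    linarith

/-- Hoeffding's lemma on an interval of length `3`: the exponent is `(3/2) ^ 2 / 2 = 9/8` times `t ^
2`. -/
theorem integral_exp_comparisonMeasure_le (t : ℝ) :
    ∫ y, Real.exp (t * y) ∂comparisonMeasure ≤ Real.exp (9 / 8 * t ^ 2) := by
  have hb : ∀ᵐ y ∂comparisonMeasure, y ∈ Set.Icc (-1 : ℝ) 2 := by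
    rw [ae_iff]
    have hs : MeasurableSet {a : ℝ | ¬ a ∈ Set.Icc (-1 : ℝ) 2} := measurableSet_Icc.compl
    rw [comparisonMeasure]
    exact bernoulliMeasure_apply_of_notMem_of_notMem _ hs (by simp; norm_num) (by simp; norm_num)
  have h := (hasSubgaussianMGF_of_mem_Icc_of_integral_eq_zero (X := fun y => y)
    (μ := comparisonMeasure) (a := -1) (b := 2) measurable_id.aemeasurable hb
    (by rw [integral_comparisonMeasure]; norm_num)).mgf_le t
  refine h.trans_eq ?_
  congr 1
  have : ‖(2 : ℝ) - -1‖ = 3 := by norm_num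
  push_cast
  rw [this]
  ring

theorem integral_exp_sum_le {ι : Type*} [Fintype ι] (c : ι → ℝ) (t : ℝ) :
    ∫ ω, Real.exp (t * ∑ e, ω e * c e) ∂Measure.pi (fun _ : ι => comparisonMeasure) ≤
      Real.exp (9 / 8 * t ^ 2 * ∑ e, c e ^ 2) := by
  have : ∀ ω : ι → ℝ, Real.exp (t * ∑ e, ω e * c e) = ∏ e, Real.exp (t * c e * ω e) := by
    intro ω
    rw [← Real.exp_sum, Finset.mul_sum]
    congr 1
    exact Finset.sum_congr rfl fun e _ => by ring
  simp only [this]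
  rw [integral_fintype_prod_eq_prod (fun e y => Real.exp (t * c e * y)), Finset.mul_sum,
    Real.exp_sum]
  refine Finset.prod_le_prod (fun e _ => integral_nonneg fun y => (Real.exp_pos _).le) fun e _ => ?_
  refine (integral_exp_comparisonMeasure_le _).trans_eq ?_
  congr 1
  ring

theorem integrable_exp_sum {ι : Type*} [Fintype ι] (c : ι → ℝ) (t : ℝ) :
    Integrable (fun ω => Real.exp (t * ∑ e, ω e * c e))
      (Measure.pi (fun _ : ι => comparisonMeasure)) := by
  have : ∀ ω : ι → ℝ, Real.exp (t * ∑ e, ω e * c e) = ∏ e, Real.exp (t * c e * ω e) := by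
    intro ω
    rw [← Real.exp_sum, Finset.mul_sum]
    congr 1
    exact Finset.sum_congr rfl fun e _ => by ring
  simp only [this]
  exact Integrable.fintype_prod (f := fun e y => Real.exp (t * c e * y))
    fun e => integrable_comparisonMeasure _

/-- One term of the exponential series at `√m * |x|`, with `(2 * m)! ≤ (2 * m) ^ (2 * m)`. The scale
`√m` makes the subgaussian exponent linear in `m`. -/
theorem pow_two_mul_le_exp {m : ℕ} (hm : 0 < m) (x : ℝ) :
    x ^ (2 * m) ≤
      (4 * m) ^ m * (Real.exp (Real.sqrt m * x) + Real.exp (-Real.sqrt m * x)) := by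
  have hm' : (0 : ℝ) < m := by exact_mod_cast hm
  have h1 := Real.pow_div_factorial_le_exp (|Real.sqrt m * x|) (abs_nonneg _) (2 * m)
  have h2 : Real.exp |Real.sqrt m * x| ≤
      Real.exp (Real.sqrt m * x) + Real.exp (-Real.sqrt m * x) := by
    rw [neg_mul]
    rcases abs_choice (Real.sqrt m * x) with h | h <;> rw [h] <;>
      linarith [Real.exp_pos (Real.sqrt m * x), Real.exp_pos (-(Real.sqrt m * x))]
  have h3 : ((2 * m).factorial : ℝ) ≤ (4 * m) ^ m * m ^ m := by
    calc ((2 * m).factorial : ℝ) ≤ ((2 * m : ℕ) : ℝ) ^ (2 * m) := by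
          exact_mod_cast Nat.factorial_le_pow _
      _ = _ := by
          push_cast
          rw [pow_mul, ← mul_pow]
          congr 1; ring
  have h4 : |Real.sqrt m * x| ^ (2 * m) = m ^ m * x ^ (2 * m) := by
    rw [pow_mul, sq_abs, mul_pow, Real.sq_sqrt hm'.le, mul_pow, ← pow_mul]
  rw [h4, div_le_iff₀ (by positivity)] at h1
  have h5 : (m : ℝ) ^ m * x ^ (2 * m) ≤ m ^ m *
      ((4 * m) ^ m * (Real.exp (Real.sqrt m * x) + Real.exp (-Real.sqrt m * x))) := by
    calc _ ≤ _ := h1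
      _ ≤ (Real.exp (Real.sqrt m * x) + Real.exp (-Real.sqrt m * x)) * ((4 * m) ^ m * m ^ m) := by
          gcongr
      _ = _ := by ring
  exact le_of_mul_le_mul_left h5 (by positivity)

theorem integral_sum_pow_le {ι : Type*} [Fintype ι] {c : ι → ℝ} (hc : ∑ e, c e ^ 2 ≤ 2)
    {m : ℕ} (hm : 0 < m) :
    Integrable (fun ω : ι → ℝ => (∑ e, ω e * c e) ^ (2 * m))
      (Measure.pi (fun _ : ι => comparisonMeasure)) ∧
    ∫ ω, (∑ e, ω e * c e) ^ (2 * m) ∂Measure.pi (fun _ : ι => comparisonMeasure) ≤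
      (4 * m) ^ m * (2 * Real.exp (9 / 4 * m)) := by
  have hi : Integrable (fun ω : ι → ℝ => (4 * m : ℝ) ^ m *
      (Real.exp (Real.sqrt m * ∑ e, ω e * c e) + Real.exp (-Real.sqrt m * ∑ e, ω e * c e)))
      (Measure.pi (fun _ : ι => comparisonMeasure)) :=
    ((integrable_exp_sum c _).add (integrable_exp_sum c _)).const_mul _
  have hi' : Integrable (fun ω : ι → ℝ => (∑ e, ω e * c e) ^ (2 * m))
      (Measure.pi (fun _ : ι => comparisonMeasure)) := by
    have hms : Measurable fun ω : ι → ℝ => (∑ e, ω e * c e) ^ (2 * m) := by fun_prop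
    refine hi.mono' hms.aestronglyMeasurable (Filter.Eventually.of_forall fun ω => ?_)
    rw [Real.norm_of_nonneg ((even_two_mul m).pow_nonneg _)]
    exact pow_two_mul_le_exp hm _
  refine ⟨hi', (integral_mono hi' hi fun ω => pow_two_mul_le_exp hm _).trans ?_⟩
  rw [integral_const_mul, integral_add (integrable_exp_sum c _) (integrable_exp_sum c _)]
  have hb : ∀ t : ℝ, t ^ 2 = m → Real.exp (9 / 8 * t ^ 2 * ∑ e, c e ^ 2) ≤
      Real.exp (9 / 4 * m) := by
    intro t ht
    rw [ht]
    refine Real.exp_le_exp.2 ?_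
    have : (0 : ℝ) ≤ 9 / 8 * m := by positivity
    calc 9 / 8 * (m : ℝ) * ∑ e, c e ^ 2 ≤ 9 / 8 * m * 2 := by gcongr
      _ = _ := by ring
  have h1 := (integral_exp_sum_le c (Real.sqrt m)).trans (hb _ (Real.sq_sqrt (Nat.cast_nonneg m)))
  have h2 := (integral_exp_sum_le c (-Real.sqrt m)).trans
    (hb _ (by rw [neg_sq, Real.sq_sqrt (Nat.cast_nonneg m)]))
  gcongr
  linarith

/-- The norm is at most twice a maximum of linear forms over pairs of net points; the maximum of the
powers is bounded by their sum, which costs the squared size of the net. -/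
theorem integral_trace_comparison_le {r m : ℕ} (hr : 0 < r) (hm : 0 < m) :
    ∫ ω, (symmetrize ω ^ (2 * m)).trace ∂Measure.pi (fun _ : Pairs r => comparisonMeasure) ≤
      r * (((3 * 2 ^ 16) ^ r) ^ 2 * (4 ^ m * ((4 * m) ^ m * (2 * Real.exp (9 / 4 * m))))) := by
  set π := Measure.pi (fun _ : Pairs r => comparisonMeasure)
  let c : (Fin r → ℤ) → (Fin r → ℤ) → Pairs r → ℝ := fun y z e =>
    latticePoint y e.1.1 * latticePoint z e.1.2 + latticePoint y e.1.2 * latticePoint z e.1.1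
  have hc : ∀ y ∈ latticeNet r, ∀ z ∈ latticeNet r, ∑ e, c y z e ^ 2 ≤ 2 := by
    intro y hy z hz
    refine (sum_sq_coeff_le _ _).trans ?_
    rw [← EuclideanSpace.real_norm_sq_eq, ← EuclideanSpace.real_norm_sq_eq]
    have h1 := pow_le_one₀ (n := 2) (norm_nonneg _) (norm_latticePoint_le hr hy)
    have h2 := pow_le_one₀ (n := 2) (norm_nonneg _) (norm_latticePoint_le hr hz)
    nlinarith [mul_le_one₀ h1 (sq_nonneg ‖latticePoint z‖) h2]
  have hpt : ∀ ω : Pairs r → ℝ, (symmetrize ω ^ (2 * m)).trace ≤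
      r * ∑ y ∈ latticeNet r, ∑ z ∈ latticeNet r, 4 ^ m * (∑ e, ω e * c y z e) ^ (2 * m) := by
    intro ω
    refine (trace_pow_le_opNorm_pow _ (by omega)).trans ?_
    gcongr
    obtain ⟨y, hy, z, hz, h⟩ := exists_opNorm_le_latticePoint hr (symmetrize ω)
    rw [dotProduct_symmetrize_mulVec] at h
    calc opNorm (symmetrize ω) ^ (2 * m) ≤ (2 * |∑ e, ω e * c y z e|) ^ (2 * m) :=
          pow_le_pow_left₀ (opNorm_nonneg _) h _
      _ = 4 ^ m * (∑ e, ω e * c y z e) ^ (2 * m) := by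
          rw [mul_pow, (even_two_mul m).pow_abs, pow_mul]
          norm_num
      _ ≤ ∑ z ∈ latticeNet r, 4 ^ m * (∑ e, ω e * c y z e) ^ (2 * m) :=
          Finset.single_le_sum (f := fun z => 4 ^ m * (∑ e, ω e * c y z e) ^ (2 * m))
            (fun _ _ => mul_nonneg (by positivity) ((even_two_mul m).pow_nonneg _)) hz
      _ ≤ _ :=
          Finset.single_le_sum
            (f := fun y => ∑ z ∈ latticeNet r, 4 ^ m * (∑ e, ω e * c y z e) ^ (2 * m))
            (fun _ _ => Finset.sum_nonneg fun _ _ =>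
              mul_nonneg (by positivity) ((even_two_mul m).pow_nonneg _)) hy
  have hint : ∀ y ∈ latticeNet r, ∀ z ∈ latticeNet r,
      Integrable (fun ω : Pairs r → ℝ => 4 ^ m * (∑ e, ω e * c y z e) ^ (2 * m)) π :=
    fun y hy z hz => (integral_sum_pow_le (hc y hy z hz) hm).1.const_mul _
  have hint' : ∀ y ∈ latticeNet r, Integrable (fun ω : Pairs r → ℝ =>
      ∑ z ∈ latticeNet r, 4 ^ m * (∑ e, ω e * c y z e) ^ (2 * m)) π :=
    fun y hy => integrable_finsetSum _ (hint y hy)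
  refine (integral_mono (integrable_trace_pow (f := fun _ y => y)
    (fun _ _ => integrable_comparisonMeasure _) _)
    ((integrable_finsetSum _ hint').const_mul _) hpt).trans ?_
  rw [integral_const_mul]
  gcongr
  rw [integral_finsetSum _ hint']
  have hB : (0 : ℝ) ≤ 4 ^ m * ((4 * m) ^ m * (2 * Real.exp (9 / 4 * m))) := by positivity
  calc ∑ y ∈ latticeNet r, ∫ ω, ∑ z ∈ latticeNet r, 4 ^ m * (∑ e, ω e * c y z e) ^ (2 * m) ∂π
      ≤ ∑ _y ∈ latticeNet r, ∑ _z ∈ latticeNet r,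
          4 ^ m * ((4 * m) ^ m * (2 * Real.exp (9 / 4 * m))) := by
        refine Finset.sum_le_sum fun y hy => ?_
        rw [integral_finsetSum _ (hint y hy)]
        refine Finset.sum_le_sum fun z hz => ?_
        rw [integral_const_mul]
        gcongr
        exact (integral_sum_pow_le (hc y hy z hz) hm).2
    _ = ((latticeNet r).card : ℝ) ^ 2 * (4 ^ m * ((4 * m) ^ m * (2 * Real.exp (9 / 4 * m)))) := by
        rw [Finset.sum_const, Finset.sum_const, nsmul_eq_mul, nsmul_eq_mul, sq, mul_assoc]
    _ ≤ _ := by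
        gcongr
        exact card_latticeNet_le r

end Comparison

/-! ### Tail bound for the norm of a sparse random symmetric matrix -/

section Tail

/-- For `r = R * m` the size of the net is exponential in `m`, so it only affects the base. One of
the three powers of `3 * 2 ^ 16` absorbs the prefactor `r`. -/
theorem integral_trace_comparison_le_pow (R : ℕ) (hR : 0 < R) {m : ℕ} (hm : 0 < m) :
    ∫ ω, (symmetrize ω ^ (2 * m)).trace
        ∂Measure.pi (fun _ : Pairs (R * m) => comparisonMeasure) ≤
      ((3 * 2 ^ 16) ^ (3 * R) * (32 * Real.exp (9 / 4)) * m) ^ m := by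
  refine (integral_trace_comparison_le (Nat.mul_pos hR hm) hm).trans ?_
  have h1 : ((R * m : ℕ) : ℝ) ≤ (3 * 2 ^ 16) ^ (R * m) := by
    exact_mod_cast (Nat.lt_pow_self (n := R * m) (a := 3 * 2 ^ 16) (by norm_num)).le
  have h2 : (2 : ℝ) ≤ 2 ^ m := by
    simpa using pow_le_pow_right₀ (one_le_two (α := ℝ)) hm
  calc _ ≤ (3 * 2 ^ 16 : ℝ) ^ (R * m) * (((3 * 2 ^ 16) ^ (R * m)) ^ 2 *
        (4 ^ m * ((4 * m) ^ m * (2 ^ m * Real.exp (9 / 4 * m))))) := by gcongr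
    _ = _ := by
      have e : Real.exp (9 / 4 * m) = Real.exp (9 / 4) ^ m := by
        rw [← Real.exp_nat_mul, mul_comm]
      have e' : (32 : ℝ) ^ m = 4 ^ m * 4 ^ m * 2 ^ m := by
        rw [← mul_pow, ← mul_pow]; norm_num
      generalize (3 * 2 ^ 16 : ℝ) = B
      simp only [e, mul_pow, e']
      ring

/-- With overwhelming probability, a random symmetric `n × n` matrix with independent centered
entries of variance at most `p` has norm of order `√(log k)`, provided that `n * p` is of order
`log k`. -/
theorem exists_opNorm_tail (γ : ℝ) : ∃ K : ℝ, 0 < K ∧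
    ∀ (n k : ℕ) (_ : 2 ≤ k) (p : ℝ) (_ : 0 ≤ p) (_ : p ≤ 1) (_ : n * p ≤ γ * Real.log k)
      (X : Type) [MeasurableSpace X] (μ : Pairs n → Measure X) [∀ e, IsProbabilityMeasure (μ e)]
      (f : Pairs n → X → ℝ) (_ : ∀ e (j : ℕ), Integrable (fun x => f e x ^ j) (μ e))
      (_ : ∀ e, ∫ x, f e x ∂μ e = 0) (_ : ∀ e (j : ℕ), 2 ≤ j → |∫ x, f e x ^ j ∂μ e| ≤ p),
      (Measure.pi μ).real
        {ω | K * Real.sqrt (Real.log k) < opNorm (symmetrize fun e => f e (ω e))} ≤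
          n / (k : ℝ) ^ 2 := by
  -- `⌈γ⌉₊ * m` covers `n * p`, and `2 * m` covers `m + 1`.
  set R : ℕ := ⌈γ⌉₊ + 2 with hR
  set Q : ℝ := (3 * 2 ^ 16) ^ (3 * R) * (32 * Real.exp (9 / 4)) with hQ
  have hQ0 : 0 < Q := by positivity
  -- `K ^ 2 * l` beats the moment base `Q * m ≤ 2 * Q * l` by the factor `exp 2`, so Markov gains
  -- `exp (-2 * m) ≤ k ^ (-2)`.
  refine ⟨Real.sqrt (2 * Q * Real.exp 2), by positivity, ?_⟩
  intro n k hk p hp0 hp1 hnp X _ μ _ f hf hf0 hfp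
  set l := Real.log k with hl
  have hk0 : (0 : ℝ) < k := by exact_mod_cast (by omega : 0 < k)
  have hl2 : 1 ≤ 2 * l := by
    have : Real.log 2 ≤ l := Real.log_le_log (by norm_num) (by exact_mod_cast hk)
    linarith [Real.log_two_gt_d9]
  have hl0 : 0 < l := by linarith
  -- The power of two `m` satisfies `l < m ≤ 2 * l`: large enough for the gain in probability, small
  -- enough for the norm bound.
  obtain ⟨j, hj1, hj2⟩ := exists_nat_pow_near hl2 one_lt_two
  set m : ℕ := 2 ^ j with hm
  have hmR : (m : ℝ) = 2 ^ j := by rw [hm]; push_cast; rfl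
  have hm0 : 0 < m := by positivity
  have hm1 : (1 : ℝ) ≤ m := by exact_mod_cast hm0
  rw [← hmR] at hj1
  rw [pow_succ, ← hmR] at hj2
  have hml : l < m := by linarith
  have hr : (n : ℝ) * p + m + 1 ≤ ((R * m : ℕ) : ℝ) := by
    have h1 : γ * l ≤ ⌈γ⌉₊ * m := mul_le_mul (Nat.le_ceil γ) hml.le hl0.le (by positivity)
    rw [hR]
    push_cast
    linarith
  have hE : ∫ ω, (symmetrize (fun e => f e (ω e)) ^ (2 * m)).trace ∂Measure.pi μ ≤
      n * (Q * m) ^ m := by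
    refine (integral_trace_pow_le (g := fun _ y => y) hp0 hp1 hr hf hf0 hfp
      (fun _ _ => integrable_comparisonMeasure _)
      (fun _ => by rw [integral_comparisonMeasure]; norm_num)
      (fun _ _ hj => one_le_integral_pow_comparisonMeasure hj)).trans ?_
    gcongr
    exact integral_trace_comparison_le_pow R (by omega) hm0
  set K := Real.sqrt (2 * Q * Real.exp 2) with hK
  have hpow : ∀ ω : Pairs n → X, opNorm (symmetrize fun e => f e (ω e)) ^ (2 * m) ≤
      (symmetrize (fun e => f e (ω e)) ^ (2 * m)).trace :=
    fun ω => opNorm_pow_le_trace (isSymm_symmetrize _) j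
  have hmarkov := mul_meas_ge_le_integral_of_nonneg (μ := Measure.pi μ)
    (Filter.Eventually.of_forall fun ω =>
      (pow_nonneg (opNorm_nonneg _) _).trans (hpow ω))
    (integrable_trace_pow hf (2 * m)) ((K * Real.sqrt l) ^ (2 * m))
  have hε : (K * Real.sqrt l) ^ (2 * m) = (2 * Q * Real.exp 2 * l) ^ m := by
    rw [pow_mul, mul_pow, Real.sq_sqrt hl0.le, hK, Real.sq_sqrt (by positivity)]
  have hsub : (Measure.pi μ).real
        {ω | K * Real.sqrt l < opNorm (symmetrize fun e => f e (ω e))} ≤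
      (Measure.pi μ).real {ω | (K * Real.sqrt l) ^ (2 * m) ≤
        (symmetrize (fun e => f e (ω e)) ^ (2 * m)).trace} := by
    refine measureReal_mono fun ω hω => ?_
    exact (pow_le_pow_left₀ (by positivity) (le_of_lt hω) _).trans (hpow ω)
  rw [hε] at hmarkov hsub
  have hfin : (n : ℝ) * (Q * m) ^ m ≤ (2 * Q * Real.exp 2 * l) ^ m * (n / (k : ℝ) ^ 2) := by
    have h1 : (Q * m) ^ m ≤ (2 * Q * l) ^ m := by
      refine pow_le_pow_left₀ (by positivity) ?_ _
      calc Q * m ≤ Q * (2 * l) := by gcongr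
        _ = _ := by ring
    have h2 : (k : ℝ) ^ 2 ≤ Real.exp 2 ^ m := by
      rw [← Real.exp_log hk0, ← Real.exp_nat_mul, ← Real.exp_nat_mul]
      refine Real.exp_le_exp.2 ?_
      push_cast
      linarith
    rw [mul_div_assoc', le_div_iff₀ (by positivity)]
    calc (n : ℝ) * (Q * m) ^ m * k ^ 2 ≤ n * (2 * Q * l) ^ m * Real.exp 2 ^ m := by gcongr
      _ = _ := by rw [mul_pow, mul_pow _ l, mul_pow _ (Real.exp 2), mul_pow]; ring
  exact hsub.trans (le_of_mul_le_mul_left (hmarkov.trans (hE.trans hfin)) (by positivity))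

end Tail

/-! ### Concentration of the signed and unsigned adjacency matrices -/

section Concentration

/-- The joint law of the indicator of an edge and the indicator of a negative sign. -/
noncomputable def edgeMeasure (p s : unitInterval) : Measure (ℝ × ℝ) :=
  (bernoulliMeasure (1 : ℝ) 0 p).prod (bernoulliMeasure (1 : ℝ) 0 s)

instance (p s : unitInterval) : IsProbabilityMeasure (edgeMeasure p s) := by
  unfold edgeMeasure; infer_instance

theorem edgeMeasure_eq (p s : unitInterval) : edgeMeasure p s =
    unitInterval.toNNReal p • bernoulliMeasure ((1 : ℝ), (1 : ℝ)) (1, 0) s +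
      unitInterval.toNNReal (unitInterval.symm p) • bernoulliMeasure ((0 : ℝ), (1 : ℝ)) (0, 0) s := by
  rw [edgeMeasure, bernoulliMeasure_def 1 0 p, Measure.add_prod, Measure.prod_smul_left,
    Measure.prod_smul_left, Measure.dirac_prod, Measure.dirac_prod,
    map_bernoulliMeasure' _ _ measurable_prodMk_left,
    map_bernoulliMeasure' _ _ measurable_prodMk_left]

theorem integrable_edgeMeasure (p s : unitInterval) (g : ℝ × ℝ → ℝ) :
    Integrable g (edgeMeasure p s) := by
  rw [edgeMeasure_eq]
  exact (integrable_bernoulliMeasure _ _ _ _).smul_measure_nnreal.add_measure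
    (integrable_bernoulliMeasure _ _ _ _).smul_measure_nnreal

theorem integral_edgeMeasure (p s : unitInterval) (g : ℝ × ℝ → ℝ) :
    ∫ x, g x ∂edgeMeasure p s =
      p * (s * g (1, 1) + (1 - s) * g (1, 0)) + (1 - p) * (s * g (0, 1) + (1 - s) * g (0, 0)) := by
  rw [edgeMeasure_eq, integral_add_measure
    (integrable_bernoulliMeasure _ _ _ _).smul_measure_nnreal
    (integrable_bernoulliMeasure _ _ _ _).smul_measure_nnreal,
    integral_smul_nnreal_measure, integral_smul_nnreal_measure,
    integral_bernoulliMeasure, integral_bernoulliMeasure]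
  simp [NNReal.smul_def, mul_add]

theorem ae_edgeMeasure (p s : unitInterval) :
    ∀ᵐ x ∂edgeMeasure p s, (x.1 = 0 ∨ x.1 = 1) ∧ (x.2 = 0 ∨ x.2 = 1) := by
  have hset : {x : ℝ × ℝ | ¬ ((x.1 = 0 ∨ x.1 = 1) ∧ (x.2 = 0 ∨ x.2 = 1))} =
      (({0, 1} : Set ℝ) ×ˢ ({0, 1} : Set ℝ))ᶜ := by
    ext x; simp [Set.mem_prod]
  have hm : MeasurableSet ((({0, 1} : Set ℝ) ×ˢ ({0, 1} : Set ℝ))ᶜ) := by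
    measurability
  rw [ae_iff, hset, edgeMeasure_eq, Measure.add_apply, Measure.smul_apply, Measure.smul_apply,
    bernoulliMeasure_apply_of_notMem_of_notMem _ hm (by simp) (by simp),
    bernoulliMeasure_apply_of_notMem_of_notMem _ hm (by simp) (by simp)]
  simp

/-- For variables bounded by `1`, higher moments are dominated by the second, so a variance bound
suffices for the trace method. -/
theorem abs_integral_pow_edgeMeasure_le (p s : unitInterval) {g : ℝ × ℝ → ℝ}
    (hg : ∀ a b : ℝ, (a = 0 ∨ a = 1) → (b = 0 ∨ b = 1) → |g (a, b)| ≤ 1) {j : ℕ} (hj : 2 ≤ j) :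
    |∫ x, g x ^ j ∂edgeMeasure p s| ≤ ∫ x, g x ^ 2 ∂edgeMeasure p s := by
  refine (abs_integral_le_integral_abs).trans ?_
  refine integral_mono_ae (integrable_edgeMeasure _ _ _) (integrable_edgeMeasure _ _ _) ?_
  filter_upwards [ae_edgeMeasure p s] with x hx
  have h := hg x.1 x.2 hx.1 hx.2
  simp only [abs_pow]
  rw [← sq_abs (g x)]
  exact pow_le_pow_of_le_one (abs_nonneg _) h hj

variable {n : ℕ}

/-- The product measure underlying the signed inhomogeneous Erdős–Rényi model. -/
noncomputable def pairsMeasure (P S : Matrix (Fin n) (Fin n) unitInterval) :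
    Measure (Pairs n → ℝ × ℝ) :=
  Measure.pi fun e : Pairs n => edgeMeasure (P e.1.1 e.1.2) (S e.1.1 e.1.2)

instance (P S : Matrix (Fin n) (Fin n) unitInterval) : IsProbabilityMeasure (pairsMeasure P S) := by
  unfold pairsMeasure; infer_instance

theorem assemble_eq_symmetrize (ω : Pairs n → ℝ × ℝ) :
    assemble ω = symmetrize fun e => (ω e).1 * (1 - 2 * (ω e).2) := rfl

theorem eq_symmetrize {M : Matrix (Fin n) (Fin n) ℝ} (hM : M.IsSymm) (h0 : ∀ i, M i i = 0) :
    M = symmetrize fun e => M e.1.1 e.1.2 := by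
  ext i j
  rcases lt_trichotomy i j with h | rfl | h
  · simp [symmetrize, h]
  · rw [h0, symmetrize_apply_self]
  · simp [symmetrize, h, h.not_gt, hM.apply]

theorem symmetrize_smul_add (a b : ℝ) (x y : Pairs n → ℝ) :
    a • symmetrize x + b • symmetrize y = symmetrize fun e => a * x e + b * y e := by
  ext i j
  rcases lt_trichotomy i j with h | rfl | h
  · simp [symmetrize, h]
  · simp [symmetrize]
  · simp [symmetrize, h, h.not_gt]

theorem unitInterval_sign_mem (s : unitInterval) : |1 - 2 * (s : ℝ)| ≤ 1 := by
  have h1 := s.2.1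
  have h2 := s.2.2
  rw [abs_le]; constructor <;> linarith

theorem abs_mul_sign_le (p s : unitInterval) : |(p : ℝ) * (1 - 2 * s)| ≤ p := by
  rw [abs_mul, abs_of_nonneg p.2.1]
  exact mul_le_of_le_one_right p.2.1 (unitInterval_sign_mem s)

theorem exists_opNorm_adjacency_tail (γ : ℝ) : ∃ K : ℝ, 0 < K ∧
    ∀ (n k : ℕ) (_ : 2 ≤ k) (p : ℝ) (_ : 0 ≤ p) (_ : p ≤ 1) (_ : n * p ≤ γ * Real.log k)
      (P S : Matrix (Fin n) (Fin n) unitInterval) (_ : P.IsSymm) (_ : S.IsSymm)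
      (_ : ∀ i, P i i = 0) (_ : ∀ i j, (P i j : ℝ) ≤ p),
      (pairsMeasure P S).real {ω | K * Real.sqrt (Real.log k) <
          opNorm (assemble ω - meanAdj P S)} ≤ n / (k : ℝ) ^ 2 ∧
      (pairsMeasure P S).real {ω | K * Real.sqrt (Real.log k) <
          opNorm (symmetrize (fun e => (ω e).1) - P.map (fun x => (x : ℝ)))} ≤ n / (k : ℝ) ^ 2 := by
  obtain ⟨K, hK, h⟩ := exists_opNorm_tail γ
  refine ⟨2 * K, by positivity, ?_⟩
  intro n k hk p hp0 hp1 hnp P S hP hS hP0 hPp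
  constructor
  -- A centered signed entry can be as large as `2`; halving makes it bounded by `1`, which is why
  -- the constant is `2 * K`.
  · let f : Pairs n → ℝ × ℝ → ℝ := fun e x => 1 / 2 * (x.1 * (1 - 2 * x.2)) +
      (-(1 / 2)) * ((P e.1.1 e.1.2 : ℝ) * (1 - 2 * (S e.1.1 e.1.2 : ℝ)))
    have hA : ∀ ω : Pairs n → ℝ × ℝ, assemble ω - meanAdj P S =
        (2 : ℝ) • symmetrize fun e => f e (ω e) := by
      intro ω
      rw [← symmetrize_smul_add, assemble_eq_symmetrize]
      have : meanAdj P S = symmetrize fun e => meanAdj P S e.1.1 e.1.2 := by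
        refine eq_symmetrize (Matrix.IsSymm.ext fun i j => ?_) fun i => ?_
        · simp only [meanAdj, Matrix.of_apply, hP.apply i j, hS.apply i j]
        · simp [meanAdj, hP0]
      rw [this, smul_add, smul_smul, smul_smul]
      norm_num
      rw [sub_eq_add_neg]
      rfl
    refine le_trans (measureReal_mono ?_) (h n k hk p hp0 hp1 hnp (ℝ × ℝ)
      (fun e => edgeMeasure (P e.1.1 e.1.2) (S e.1.1 e.1.2)) f
      (fun e j => integrable_edgeMeasure _ _ _) ?_ ?_)
    · intro ω hω
      simp only [Set.mem_ofPred_eq, hA, opNorm_smul, abs_two] at hω ⊢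
      linarith
    · intro e
      rw [integral_edgeMeasure]
      simp only [f]
      ring
    · intro e j hj
      refine (abs_integral_pow_edgeMeasure_le _ _ ?_ hj).trans ?_
      · intro a b ha hb
        have h1 := abs_le.1 ((abs_mul_sign_le (P e.1.1 e.1.2) (S e.1.1 e.1.2)).trans
          (P e.1.1 e.1.2).2.2)
        simp only [f]
        rw [abs_le]
        rcases ha with rfl | rfl <;> rcases hb with rfl | rfl <;> constructor <;> linarith
      · refine le_trans ?_ (hPp e.1.1 e.1.2)
        rw [integral_edgeMeasure]
        simp only [f]
        have h1 := (P e.1.1 e.1.2).2.1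
        nlinarith [sq_nonneg ((P e.1.1 e.1.2 : ℝ) * (1 - 2 * (S e.1.1 e.1.2 : ℝ)))]
  · let f : Pairs n → ℝ × ℝ → ℝ := fun e x => 1 * x.1 + (-1) * (P e.1.1 e.1.2 : ℝ)
    have hA : ∀ ω : Pairs n → ℝ × ℝ, symmetrize (fun e => (ω e).1) - P.map (fun x => (x : ℝ)) =
        symmetrize fun e => f e (ω e) := by
      intro ω
      rw [← symmetrize_smul_add]
      have : P.map (fun x => (x : ℝ)) = symmetrize fun e => (P e.1.1 e.1.2 : ℝ) := by
        refine eq_symmetrize (Matrix.IsSymm.ext fun i j => ?_) fun i => ?_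
        · simp only [Matrix.map_apply, hP.apply i j]
        · simp [hP0]
      rw [this, one_smul, neg_one_smul, sub_eq_add_neg]
    refine le_trans (measureReal_mono ?_) (h n k hk p hp0 hp1 hnp (ℝ × ℝ)
      (fun e => edgeMeasure (P e.1.1 e.1.2) (S e.1.1 e.1.2)) f
      (fun e j => integrable_edgeMeasure _ _ _) ?_ ?_)
    · intro ω hω
      simp only [Set.mem_ofPred_eq, hA] at hω ⊢
      have : 0 ≤ K * Real.sqrt (Real.log k) := by positivity
      linarith
    · intro e
      rw [integral_edgeMeasure]
      simp only [f]
      ring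
    · intro e j hj
      have h0 := (P e.1.1 e.1.2).2.1
      have h1 := (P e.1.1 e.1.2).2.2
      refine (abs_integral_pow_edgeMeasure_le _ _ ?_ hj).trans ?_
      · intro a b ha hb
        simp only [f]
        rw [abs_le]
        rcases ha with rfl | rfl <;> constructor <;> linarith
      · refine le_trans ?_ (hPp e.1.1 e.1.2)
        rw [integral_edgeMeasure]
        simp only [f]
        nlinarith [sq_nonneg (P e.1.1 e.1.2 : ℝ)]

theorem row_sum_symmetrize (x : Pairs n → ℝ) (i : Fin n) :
    ∑ j, symmetrize x i j =
      ∑ e : Pairs n, x e * ((if e.1.1 = i then 1 else 0) + (if e.1.2 = i then 1 else 0)) := by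
  have := dotProduct_symmetrize_mulVec x (Pi.single i 1) 1
  rw [single_one_dotProduct] at this
  simpa [Matrix.mulVec, dotProduct, Pi.single_apply] using this

/-- Lower tail of the degrees. -/
theorem measure_row_sum_le (P S : Matrix (Fin n) (Fin n) unitInterval) (hP : P.IsSymm)
    (hP0 : ∀ i, P i i = 0) (i : Fin n) (a : ℝ) :
    (pairsMeasure P S).real {ω | ∑ j, symmetrize (fun e => (ω e).1) i j ≤ a} ≤
      Real.exp (2 * a - 3 / 4 * meanDegree P i) := by
  set c : Pairs n → ℝ := fun e => (if e.1.1 = i then 1 else 0) + (if e.1.2 = i then 1 else 0)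
    with hc
  have hc01 : ∀ e, c e = 0 ∨ c e = 1 := by
    intro e
    have := e.2
    simp only [hc]
    split_ifs with h1 h2
    · rw [h1, h2] at this; exact absurd this (lt_irrefl _)
    all_goals simp
  have hD : meanDegree P i = ∑ e, (P e.1.1 e.1.2 : ℝ) * c e := by
    rw [← row_sum_symmetrize, meanDegree]
    have : P.map (fun x => (x : ℝ)) = symmetrize fun e => (P e.1.1 e.1.2 : ℝ) := by
      refine eq_symmetrize (Matrix.IsSymm.ext fun i j => ?_) fun i => ?_
      · simp only [Matrix.map_apply, hP.apply i j]
      · simp [hP0]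
    rw [← this]
    rfl
  have he : ∀ ω : Pairs n → ℝ × ℝ, Real.exp (-2 * ∑ j, symmetrize (fun e => (ω e).1) i j) =
      ∏ e, Real.exp (-2 * c e * (ω e).1) := by
    intro ω
    rw [row_sum_symmetrize, ← Real.exp_sum, Finset.mul_sum]
    congr 1
    exact Finset.sum_congr rfl fun e _ => by ring
  have hint : Integrable (fun ω : Pairs n → ℝ × ℝ =>
      Real.exp (-2 * ∑ j, symmetrize (fun e => (ω e).1) i j)) (pairsMeasure P S) := by
    simp only [he, pairsMeasure]
    exact Integrable.fintype_prod (f := fun (e : Pairs n) (x : ℝ × ℝ) => Real.exp (-2 * c e * x.1))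
      (μ := fun e => edgeMeasure (P e.1.1 e.1.2) (S e.1.1 e.1.2))
      fun e => integrable_edgeMeasure _ _ _
  -- The Chernoff parameter is `2`: one edge contributes `1 - P * (1 - exp (-2)) ≤ exp (-3 / 4 *
  -- P)`.
  have hexp2 : Real.exp (-2) ≤ 1 / 4 := by
    have h1 := Real.exp_one_gt_d9
    have h2 : Real.exp (-2) * Real.exp 2 = 1 := by rw [← Real.exp_add]; norm_num
    have h3 : Real.exp 2 = Real.exp 1 * Real.exp 1 := by rw [← Real.exp_add]; norm_num
    have h4 : 4 ≤ Real.exp 2 := by rw [h3]; nlinarith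
    nlinarith [Real.exp_pos (-2)]
  have hE : ∫ ω, Real.exp (-2 * ∑ j, symmetrize (fun e => (ω e).1) i j) ∂pairsMeasure P S ≤
      Real.exp (-(3 / 4) * meanDegree P i) := by
    simp only [he]
    rw [pairsMeasure, integral_fintype_prod_eq_prod
      (fun (e : Pairs n) (x : ℝ × ℝ) => Real.exp (-2 * c e * x.1))
      (μ := fun e => edgeMeasure (P e.1.1 e.1.2) (S e.1.1 e.1.2)), hD, Finset.mul_sum, Real.exp_sum]
    refine Finset.prod_le_prod (fun e _ => integral_nonneg fun x => (Real.exp_pos _).le)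
      fun e _ => ?_
    rw [integral_edgeMeasure]
    have h0 := (P e.1.1 e.1.2).2.1
    rcases hc01 e with h | h
    · rw [h]; simp
    · rw [h]
      refine le_trans ?_ (Real.add_one_le_exp _)
      norm_num
      nlinarith
  have hmarkov := mul_meas_ge_le_integral_of_nonneg (μ := pairsMeasure P S)
    (Filter.Eventually.of_forall fun ω => (Real.exp_pos _).le) hint (Real.exp (-2 * a))
  have hsub : (pairsMeasure P S).real {ω | ∑ j, symmetrize (fun e => (ω e).1) i j ≤ a} ≤
      (pairsMeasure P S).real {ω | Real.exp (-2 * a) ≤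
        Real.exp (-2 * ∑ j, symmetrize (fun e => (ω e).1) i j)} := by
    refine measureReal_mono fun ω hω => Real.exp_le_exp.2 ?_
    have : ∑ j, symmetrize (fun e => (ω e).1) i j ≤ a := hω
    linarith
  refine hsub.trans ?_
  refine le_of_mul_le_mul_left (hmarkov.trans (hE.trans_eq ?_)) (Real.exp_pos (-2 * a))
  rw [← Real.exp_add]
  congr 1
  ring

end Concentration

/-! ### Perturbation of normalized Laplacians -/

section Perturbation

variable {n : ℕ}

theorem normalize_eq {d : Fin n → ℝ} (hd : ∀ i, 0 < d i) (A : Matrix (Fin n) (Fin n) ℝ) :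
    normalize d A = 1 - Matrix.diagonal (fun i => 1 / Real.sqrt (d i)) * A *
      Matrix.diagonal (fun i => 1 / Real.sqrt (d i)) := by
  have h : invSqrtDiag d = Matrix.diagonal (fun i => 1 / Real.sqrt (d i)) := by
    rw [invSqrtDiag]
    congr 1
    funext i
    rw [if_neg (hd i).ne']
  rw [normalize, h, mul_sub, sub_mul, Matrix.diagonal_mul_diagonal, Matrix.diagonal_mul_diagonal]
  congr 1
  rw [← Matrix.diagonal_one]
  congr 1
  funext i
  have hs : Real.sqrt (d i) ≠ 0 := (Real.sqrt_pos.2 (hd i)).ne'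
  nth_rewrite 2 [← Real.mul_self_sqrt (hd i).le]
  field_simp

/-- Rationalizing gives `(x - y) ^ 2` over `x * y * (√x + √y) ^ 2`, and each of these three factors
is at least `a`. -/
theorem sq_inv_sqrt_sub_le {a x y : ℝ} (ha : 0 < a) (hx : a ≤ x) (hy : a ≤ y) :
    (1 / Real.sqrt x - 1 / Real.sqrt y) ^ 2 ≤ (x - y) ^ 2 / a ^ 3 := by
  have hx0 : 0 < x := ha.trans_le hx
  have hy0 : 0 < y := ha.trans_le hy
  have hsx := Real.sqrt_pos.2 hx0
  have hsy := Real.sqrt_pos.2 hy0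
  have e : (1 / Real.sqrt x - 1 / Real.sqrt y) ^ 2 =
      (x - y) ^ 2 / (x * y * (Real.sqrt x + Real.sqrt y) ^ 2) := by
    rw [div_sub_div _ _ hsx.ne' hsy.ne', div_pow, div_eq_div_iff (by positivity) (by positivity),
      mul_pow, Real.sq_sqrt hx0.le, Real.sq_sqrt hy0.le]
    have h : x - y = (Real.sqrt x - Real.sqrt y) * (Real.sqrt x + Real.sqrt y) := by
      ring_nf
      rw [Real.sq_sqrt hx0.le, Real.sq_sqrt hy0.le]
    rw [h]
    ring
  rw [e]
  have h1 : a ≤ (Real.sqrt x + Real.sqrt y) ^ 2 := by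
    have : Real.sqrt x ^ 2 = x := Real.sq_sqrt hx0.le
    nlinarith [mul_pos hsx hsy, sq_nonneg (Real.sqrt y)]
  have h2 : a ^ 3 ≤ x * y * (Real.sqrt x + Real.sqrt y) ^ 2 := by
    calc a ^ 3 = a * a * a := by ring
      _ ≤ _ := by gcongr
  gcongr

/-- The Frobenius norm of a matrix with bounded entries needs only `ℓ²` control of `v`, where the
product of operator norms would need a uniform bound. -/
theorem opNorm_sq_mul_diagonal_le {M : Matrix (Fin n) (Fin n) ℝ} {P : ℝ} (hM : ∀ i j, |M i j| ≤ P)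
    (v : Fin n → ℝ) : opNorm (M * Matrix.diagonal v) ^ 2 ≤ P ^ 2 * (n * ∑ i, v i ^ 2) := by
  refine (opNorm_sq_le_sum_sq _).trans ?_
  calc ∑ i, ∑ j, (M * Matrix.diagonal v) i j ^ 2 ≤ ∑ _i : Fin n, ∑ j, P ^ 2 * v j ^ 2 := by
        refine Finset.sum_le_sum fun i _ => Finset.sum_le_sum fun j _ => ?_
        rw [Matrix.mul_diagonal, mul_pow]
        gcongr ?_ * _
        exact sq_le_sq' (abs_le.1 (hM i j)).1 (abs_le.1 (hM i j)).2
    _ = _ := by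
        rw [Finset.sum_const, ← Finset.mul_sum, Finset.card_univ, Fintype.card_fin, nsmul_eq_mul]
        ring

theorem opNorm_sq_diagonal_mul_le {M : Matrix (Fin n) (Fin n) ℝ} {P : ℝ} (hM : ∀ i j, |M i j| ≤ P)
    (v : Fin n → ℝ) : opNorm (Matrix.diagonal v * M) ^ 2 ≤ P ^ 2 * (n * ∑ i, v i ^ 2) := by
  refine (opNorm_sq_le_sum_sq _).trans ?_
  calc ∑ i, ∑ j, (Matrix.diagonal v * M) i j ^ 2 ≤ ∑ i, ∑ _j : Fin n, v i ^ 2 * P ^ 2 := by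
        refine Finset.sum_le_sum fun i _ => Finset.sum_le_sum fun j _ => ?_
        rw [Matrix.diagonal_mul, mul_pow]
        gcongr _ * ?_
        exact sq_le_sq' (abs_le.1 (hM i j)).1 (abs_le.1 (hM i j)).2
    _ = _ := by
        simp only [Finset.sum_const, Finset.card_univ, Fintype.card_fin, nsmul_eq_mul]
        rw [← Finset.mul_sum, ← Finset.sum_mul]
        ring

/-- If both degree sequences are bounded below, then the difference of normalized Laplacians is
controlled by the differences of the adjacency matrices and of the degree sequences. -/
theorem opNorm_normalize_sub_le {a P N : ℝ} (ha : 0 < a) (hP : 0 ≤ P) (hN : 0 ≤ N)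
    {d D : Fin n → ℝ} (hd : ∀ i, a ≤ d i) (hD : ∀ i, a ≤ D i)
    {A B : Matrix (Fin n) (Fin n) ℝ} (hB : ∀ i j, |B i j| ≤ P) (hAB : opNorm (A - B) ≤ N)
    (hdD : ∑ i, (d i - D i) ^ 2 ≤ n * N ^ 2) :
    opNorm (normalize d A - normalize D B) ≤ N / a + 2 * (n * P * N) / a ^ 2 := by
  rw [normalize_eq (fun i => ha.trans_le (hd i)), normalize_eq (fun i => ha.trans_le (hD i))]
  set g : Fin n → ℝ := fun i => 1 / Real.sqrt (d i)
  set h : Fin n → ℝ := fun i => 1 / Real.sqrt (D i)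
  have hsa := Real.sqrt_pos.2 ha
  have hbd : ∀ x : Fin n → ℝ, (∀ i, a ≤ x i) →
      opNorm (Matrix.diagonal fun i => 1 / Real.sqrt (x i)) ≤ 1 / Real.sqrt a := by
    intro x hx
    refine opNorm_diagonal_le (by positivity) fun i => ?_
    rw [abs_of_nonneg (by positivity)]
    exact one_div_le_one_div_of_le hsa (Real.sqrt_le_sqrt (hx i))
  have hg : opNorm (Matrix.diagonal g) ≤ 1 / Real.sqrt a := hbd d hd
  have hh : opNorm (Matrix.diagonal h) ≤ 1 / Real.sqrt a := hbd D hD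
  -- Telescoping: exchange `A` for `B` first, then the two diagonal factors one at a time, so that
  -- degree errors meet only the mean matrix `B`.
  have e : (1 - Matrix.diagonal g * A * Matrix.diagonal g) -
      (1 - Matrix.diagonal h * B * Matrix.diagonal h) =
      Matrix.diagonal g * (B - A) * Matrix.diagonal g +
      (Matrix.diagonal (fun i => h i - g i) * B * Matrix.diagonal g +
        Matrix.diagonal h * (B * Matrix.diagonal fun i => h i - g i)) := by
    rw [← Matrix.diagonal_sub]
    noncomm_ring
  have hsq : P ^ 2 * (n * ∑ i, (h i - g i) ^ 2) ≤ (n * P * N / (Real.sqrt a * a)) ^ 2 := by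
    have h1 : ∑ i, (h i - g i) ^ 2 ≤ n * N ^ 2 / a ^ 3 := by
      calc ∑ i, (h i - g i) ^ 2 ≤ ∑ i, (d i - D i) ^ 2 / a ^ 3 := by
            refine Finset.sum_le_sum fun i _ => ?_
            rw [← neg_sub, neg_sq]
            exact sq_inv_sqrt_sub_le ha (hd i) (hD i)
        _ = (∑ i, (d i - D i) ^ 2) / a ^ 3 := by rw [Finset.sum_div]
        _ ≤ _ := by gcongr
    calc P ^ 2 * (n * ∑ i, (h i - g i) ^ 2) ≤ P ^ 2 * (n * (n * N ^ 2 / a ^ 3)) := by gcongr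
      _ = _ := by
          rw [div_pow, mul_pow _ a, Real.sq_sqrt ha.le]
          ring
  have h1 : opNorm (B * Matrix.diagonal fun i => h i - g i) ≤ n * P * N / (Real.sqrt a * a) :=
    le_of_sq_le_sq ((opNorm_sq_mul_diagonal_le hB _).trans hsq) (by positivity)
  have h2 : opNorm (Matrix.diagonal (fun i => h i - g i) * B) ≤ n * P * N / (Real.sqrt a * a) :=
    le_of_sq_le_sq ((opNorm_sq_diagonal_mul_le hB _).trans hsq) (by positivity)
  have t1 : opNorm (Matrix.diagonal g * (B - A) * Matrix.diagonal g) ≤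
      1 / Real.sqrt a * N * (1 / Real.sqrt a) := by
    refine (opNorm_mul_le _ _).trans (mul_le_mul ((opNorm_mul_le _ _).trans
      (mul_le_mul hg ?_ (opNorm_nonneg _) (by positivity))) hg (opNorm_nonneg _) (by positivity))
    rwa [opNorm_sub_comm]
  have t2 : opNorm (Matrix.diagonal (fun i => h i - g i) * B * Matrix.diagonal g) ≤
      n * P * N / (Real.sqrt a * a) * (1 / Real.sqrt a) :=
    (opNorm_mul_le _ _).trans (mul_le_mul h2 hg (opNorm_nonneg _) (by positivity))
  have t3 : opNorm (Matrix.diagonal h * (B * Matrix.diagonal fun i => h i - g i)) ≤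
      1 / Real.sqrt a * (n * P * N / (Real.sqrt a * a)) :=
    (opNorm_mul_le _ _).trans (mul_le_mul hh h1 (opNorm_nonneg _) (by positivity))
  rw [e]
  refine (opNorm_add_le _ _).trans ((add_le_add t1 ((opNorm_add_le _ _).trans
    (add_le_add t2 t3))).trans_eq ?_)
  have hss : Real.sqrt a * Real.sqrt a = a := Real.mul_self_sqrt ha.le
  have e1 : 1 / Real.sqrt a * N * (1 / Real.sqrt a) = N / a := by
    rw [mul_comm, ← mul_assoc, div_mul_div_comm, one_mul, hss, one_div, ← div_eq_inv_mul]
  have e2 : n * P * N / (Real.sqrt a * a) * (1 / Real.sqrt a) = n * P * N / a ^ 2 := by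
    rw [div_mul_div_comm, mul_one, mul_right_comm (Real.sqrt a), hss, sq]
  rw [e1, mul_comm (1 / Real.sqrt a), e2]
  ring

/-- The degrees of a signed graph are the row sums of its unsigned adjacency matrix. -/
theorem degree_eq_sum_sq {A : Matrix (Fin n) (Fin n) ℝ}
    (hA : ∀ i j, A i j = 0 ∨ A i j = 1 ∨ A i j = -1) (i : Fin n) :
    (degree A i : ℝ) = ∑ j, A i j ^ 2 := by
  classical
  have h : ∀ j, A i j ^ 2 = if A i j ≠ 0 then 1 else 0 := by
    intro j
    rcases hA i j with h | h | h <;> simp [h]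
  simp only [h, degree]
  rw [Finset.sum_boole, Set.ncard_eq_toFinset_card']
  congr 2
  ext j
  simp

/-- Row sums are the image of the all-ones vector, whose squared length is `n`. -/
theorem sum_sq_row_sum_sub_le (M N : Matrix (Fin n) (Fin n) ℝ) :
    ∑ i, (∑ j, M i j - ∑ j, N i j) ^ 2 ≤ n * opNorm (M - N) ^ 2 := by
  have h := sum_sq_mulVec_le (M - N) 1
  simpa [Matrix.mulVec, dotProduct, Finset.sum_sub_distrib, mul_comm] using h

end Perturbation

/-! ### The signed stochastic bisection model -/

section Bisection

theorem measurable_matrix_apply {n : ℕ} (i j : Fin n) :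
    Measurable fun M : Matrix (Fin n) (Fin n) ℝ => M i j :=
  (measurable_pi_apply j).comp (measurable_pi_apply (X := fun _ => Fin n → ℝ) i)

theorem measurable_matrix_of_entries {n : ℕ} {X : Type*} [MeasurableSpace X]
    {F : X → Matrix (Fin n) (Fin n) ℝ} (hF : ∀ i j, Measurable fun x => F x i j) : Measurable F :=
  measurable_pi_lambda (X := fun _ => Fin n → ℝ) F fun i => measurable_pi_lambda _ fun j => hF i j

theorem measurable_assemble {n : ℕ} : Measurable (assemble : (Pairs n → ℝ × ℝ) → _) := by
  refine measurable_matrix_of_entries fun i j => ?_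
  simp only [assemble, Matrix.of_apply]
  split_ifs <;> fun_prop

/-- The regular signed adjacency matrices: the degrees are at least `a`, and the signed and
unsigned adjacency matrices are at distance at most `N` of the means. -/
def regularSet {n : ℕ} (Abar Pbar : Matrix (Fin n) (Fin n) ℝ) (a N : ℝ) :
    Set (Matrix (Fin n) (Fin n) ℝ) :=
  {M | ((∀ i j, M i j = 0 ∨ M i j = 1 ∨ M i j = -1) ∧ ∀ i, a ≤ ∑ j, M i j ^ 2) ∧
    opNorm (M - Abar) ≤ N ∧ opNorm (M.map (· ^ 2) - Pbar) ≤ N}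

/-- Needed to transport the probability of the event through the law of the random matrix; the event
of the final estimate only has to contain it. -/
theorem measurableSet_regularSet {n : ℕ} (Abar Pbar : Matrix (Fin n) (Fin n) ℝ) (a N : ℝ) :
    MeasurableSet (regularSet Abar Pbar a N) := by
  have hentry := fun i j => measurable_matrix_apply (n := n) i j
  have m1 : MeasurableSet {M : Matrix (Fin n) (Fin n) ℝ |
      ∀ i j, M i j = 0 ∨ M i j = 1 ∨ M i j = -1} := by
    have : {M : Matrix (Fin n) (Fin n) ℝ | ∀ i j, M i j = 0 ∨ M i j = 1 ∨ M i j = -1} =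
        ⋂ i, ⋂ j, (fun M : Matrix (Fin n) (Fin n) ℝ => M i j) ⁻¹' {0, 1, -1} := by
      ext M; simp
    rw [this]
    exact MeasurableSet.iInter fun i => MeasurableSet.iInter fun j =>
      hentry i j (Set.toFinite _).measurableSet
  have m2 : MeasurableSet {M : Matrix (Fin n) (Fin n) ℝ | ∀ i, a ≤ ∑ j, M i j ^ 2} := by
    have : {M : Matrix (Fin n) (Fin n) ℝ | ∀ i, a ≤ ∑ j, M i j ^ 2} =
        ⋂ i, {M : Matrix (Fin n) (Fin n) ℝ | a ≤ ∑ j, M i j ^ 2} := by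
      ext M; simp
    rw [this]
    exact MeasurableSet.iInter fun i => measurableSet_le measurable_const
      (Finset.measurable_sum _ fun j _ => (hentry i j).pow_const 2)
  have f3 : Measurable fun M : Matrix (Fin n) (Fin n) ℝ => M - Abar :=
    measurable_matrix_of_entries fun i j => by
      simp only [Matrix.sub_apply]
      exact (hentry i j).sub_const _
  have f4 : Measurable fun M : Matrix (Fin n) (Fin n) ℝ => M.map (· ^ 2) - Pbar :=
    measurable_matrix_of_entries fun i j => by
      simp only [Matrix.sub_apply, Matrix.map_apply]
      exact ((hentry i j).pow_const 2).sub_const _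
  have m3 : MeasurableSet {M : Matrix (Fin n) (Fin n) ℝ | opNorm (M - Abar) ≤ N} :=
    measurableSet_le (measurable_opNorm.comp f3) measurable_const
  have m4 : MeasurableSet {M : Matrix (Fin n) (Fin n) ℝ | opNorm (M.map (· ^ 2) - Pbar) ≤ N} :=
    measurableSet_le (measurable_opNorm.comp f4) measurable_const
  exact (m1.inter m2).inter (m3.inter m4)

theorem pairsMeasure_compl_regularSet_le {n : ℕ} (P S : Matrix (Fin n) (Fin n) unitInterval)
    (a N : ℝ) :
    (pairsMeasure P S).real
        (assemble ⁻¹' regularSet (meanAdj P S) (P.map fun x => (x : ℝ)) a N)ᶜ ≤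
      ∑ i, (pairsMeasure P S).real {ω | ∑ j, symmetrize (fun e => (ω e).1) i j ≤ a} +
      ((pairsMeasure P S).real {ω | N < opNorm (assemble ω - meanAdj P S)} +
        (pairsMeasure P S).real
          {ω | N < opNorm (symmetrize (fun e => (ω e).1) - P.map fun x => (x : ℝ))}) := by
  set Z : Set (Pairs n → ℝ × ℝ) :=
    {ω | ¬ ∀ e, ((ω e).1 = 0 ∨ (ω e).1 = 1) ∧ ((ω e).2 = 0 ∨ (ω e).2 = 1)} with hZ
  have hZ0 : (pairsMeasure P S).real Z = 0 := by
    have : ∀ᵐ ω ∂pairsMeasure P S, ∀ e : Pairs n,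
        ((ω e).1 = 0 ∨ (ω e).1 = 1) ∧ ((ω e).2 = 0 ∨ (ω e).2 = 1) := by
      rw [ae_all_iff]
      intro e
      exact (Measure.tendsto_eval_ae_ae
        (μ := fun e : Pairs n => edgeMeasure (P e.1.1 e.1.2) (S e.1.1 e.1.2)) (i := e)).eventually
        (ae_edgeMeasure _ _)
    rw [measureReal_def, ae_iff.1 this, ENNReal.toReal_zero]
  have hsub : (assemble ⁻¹' regularSet (meanAdj P S) (P.map fun x => (x : ℝ)) a N)ᶜ ⊆
      Z ∪ ((⋃ i, {ω | ∑ j, symmetrize (fun e => (ω e).1) i j ≤ a}) ∪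
        ({ω | N < opNorm (assemble ω - meanAdj P S)} ∪
          {ω | N < opNorm (symmetrize (fun e => (ω e).1) - P.map fun x => (x : ℝ))})) := by
    intro ω hω
    by_contra h
    simp only [Set.mem_union, Set.mem_iUnion, Set.mem_ofPred_eq, hZ, not_or, not_not, not_exists,
      not_le, not_lt] at h
    obtain ⟨h01, hdeg, hn1, hn2⟩ := h
    -- For indicators `x` and `y`, `(x * (1 - 2 * y)) ^ 2 = x`: squaring the entries forgets the
    -- signs.
    have hmap : (assemble ω).map (· ^ 2) = symmetrize fun e => (ω e).1 := by
      ext i j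
      rw [Matrix.map_apply, assemble_eq_symmetrize]
      rcases eq_or_ne i j with rfl | hij
      · simp [symmetrize_apply_self]
      · rw [symmetrize_apply _ hij, symmetrize_apply _ hij]
        obtain ⟨h1, h2⟩ := h01 (pairOf hij)
        rcases h1 with h1 | h1 <;> rcases h2 with h2 | h2 <;> rw [h1, h2] <;> norm_num
    refine hω ⟨⟨fun i j => ?_, fun i => ?_⟩, hn1, by rwa [hmap]⟩
    · rw [assemble_eq_symmetrize]
      rcases eq_or_ne i j with rfl | hij
      · simp [symmetrize_apply_self]
      · rw [symmetrize_apply _ hij]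
        obtain ⟨h1, h2⟩ := h01 (pairOf hij)
        rcases h1 with h1 | h1 <;> rcases h2 with h2 | h2 <;> rw [h1, h2] <;> norm_num
    · refine (hdeg i).le.trans_eq (Finset.sum_congr rfl fun j _ => ?_)
      rw [← hmap, Matrix.map_apply]
  refine (measureReal_mono hsub).trans ((measureReal_union_le _ _).trans ?_)
  rw [hZ0, zero_add]
  exact (measureReal_union_le _ _).trans
    (add_le_add (measureReal_iUnion_fintype_le _) (measureReal_union_le _ _))

/-- On the regular set, the normalized Laplacian is close to the normalized mean Laplacian. -/
theorem opNorm_normLaplacian_sub_le {n : ℕ} {P S : Matrix (Fin n) (Fin n) unitInterval}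
    {a N p : ℝ} (ha : 0 < a) (hN : 0 ≤ N) (hp : 0 ≤ p) (hPp : ∀ i j, (P i j : ℝ) ≤ p)
    (hD : ∀ i, a ≤ meanDegree P i) {M : Matrix (Fin n) (Fin n) ℝ}
    (hM : M ∈ regularSet (meanAdj P S) (P.map fun x => (x : ℝ)) a N) :
    opNorm (normLaplacian M - meanNormLaplacian P S) ≤ N / a + 2 * (n * p * N) / a ^ 2 := by
  obtain ⟨⟨h01, hdeg⟩, hn1, hn2⟩ := hM
  refine opNorm_normalize_sub_le ha hp hN (fun i => ?_) hD
    (fun i j => (abs_mul_sign_le _ _).trans (hPp i j)) hn1 ?_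
  · rw [degree_eq_sum_sq h01]
    exact hdeg i
  · simp only [degree_eq_sum_sq h01]
    have h := sum_sq_row_sum_sub_le (M.map (· ^ 2)) (P.map fun x => (x : ℝ))
    simp only [Matrix.map_apply] at h
    have h2 := pow_le_pow_left₀ (opNorm_nonneg _) hn2 2
    unfold meanDegree
    exact h.trans (mul_le_mul_of_nonneg_left h2 (Nat.cast_nonneg n))

variable {k : ℕ}

theorem blockExtend_isSymm {Q : Matrix (Fin 2) (Fin 2) unitInterval} (hQ : Q.IsSymm) :
    (blockExtend (k := k) Q).IsSymm := by
  refine Matrix.IsSymm.ext fun i j => ?_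
  simp only [blockExtend, Matrix.of_apply, hQ.apply (community i) (community j), eq_comm]

theorem edgeProb_isSymm (p q : unitInterval) : (edgeProb k p q).IsSymm :=
  blockExtend_isSymm (by ext i j; fin_cases i <;> fin_cases j <;> rfl)

theorem signProb_isSymm (s : unitInterval) : (signProb k s).IsSymm :=
  blockExtend_isSymm (by ext i j; fin_cases i <;> fin_cases j <;> rfl)

theorem edgeProb_apply_self (p q : unitInterval) (i : Fin (2 * k)) : edgeProb k p q i i = 0 := by
  simp [edgeProb, blockExtend]

theorem edgeProb_apply (p q : unitInterval) (i j : Fin (2 * k)) :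
    edgeProb k p q i j = if i = j then 0 else if (i.val < k ↔ j.val < k) then p else q := by
  simp only [edgeProb, blockExtend, Matrix.of_apply, community]
  by_cases hi : i.val < k <;> by_cases hj : j.val < k <;> simp [hi, hj]

theorem edgeProb_le {p q : unitInterval} (hqp : q ≤ p) (i j : Fin (2 * k)) :
    edgeProb k p q i j ≤ p := by
  rw [edgeProb_apply]
  split_ifs
  · exact unitInterval.nonneg'
  · exact le_rfl
  · exact hqp

theorem meanDegree_edgeProb (p q : unitInterval) (i : Fin (2 * k)) :
    meanDegree (edgeProb k p q) i = k * p + k * q - p := by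
  have h1 : ∑ j : Fin (2 * k), (if (i.val < k ↔ j.val < k) then (p : ℝ) else q) =
      k * p + k * q := by
    have h0 : ∀ x y : ℝ, ∑ j : Fin (2 * k), (if j.val < k then x else y) = k * x + k * y := by
      intro x y
      rw [Fin.sum_univ_eq_sum_range (fun j => if j < k then x else y) (2 * k), two_mul,
        Finset.sum_range_add,
        Finset.sum_congr rfl (g := fun _ => x) fun j hj => by simp [Finset.mem_range.1 hj]]
      simp
    by_cases hi : i.val < k
    · simp only [hi, true_iff, h0]
    · simp only [hi, false_iff, ite_not, h0, add_comm]
  have h2 : ∀ j, (edgeProb k p q i j : ℝ) =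
      (if (i.val < k ↔ j.val < k) then (p : ℝ) else q) - if i = j then (p : ℝ) else 0 := by
    intro j
    rw [edgeProb_apply]
    by_cases hij : i = j
    · subst hij; simp
    · simp only [hij, if_false, sub_zero]
      split_ifs <;> rfl
  simp only [meanDegree, h2, Finset.sum_sub_distrib, h1]
  simp

end Bisection

end SignedGraph

open SignedGraph in
theorem proposition4p10 (γ₁ γ₂ : ℝ) (hγ₂ : 1 < γ₂) (hγ : γ₂ < γ₁)
    (s : unitInterval) (hs0 : 0 < (s : ℝ)) (hs : (s : ℝ) < 1 / 2) :
    ∃ C₁ C₂ C₃ : ℝ, 0 < C₁ ∧ 0 < C₂ ∧ 0 < C₃ ∧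
      ∀ (k : ℕ), 2 ≤ k →
      ∀ (p q : unitInterval), (p : ℝ) = γ₁ * Real.log k / k → (q : ℝ) = γ₂ * Real.log k / k →
      ∀ (Ω : Type*) [MeasurableSpace Ω] (μ : Measure Ω) [IsProbabilityMeasure μ]
        (A : Ω → Matrix (Fin (2 * k)) (Fin (2 * k)) ℝ),
        HasLaw A (SignedGraph.signedBlock k p q s) μ →
        1 - C₁ * (k : ℝ) ^ (-C₂) ≤
          μ.real {ω | SignedGraph.opNorm (SignedGraph.normLaplacian (A ω) -
              SignedGraph.meanNormLaplacian (SignedGraph.edgeProb k p q)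
                (SignedGraph.signProb k s)) ≤
            C₃ * (Real.log k) ^ (-(1 / 2) : ℝ)} := by
  obtain ⟨K, hK, htail⟩ := exists_opNorm_adjacency_tail (2 * γ₁)
  -- `2` comes from each norm event and `2 * exp (3 / 4)` from the degrees. With `a = l / 8` and `n
  -- * p = 2 * γ₁ * l`, the perturbation bound is exactly `(8 + 256 * γ₁) * K * √l / l`.
  refine ⟨4 + 2 * Real.exp (3 / 4), 1 / 4, 8 * K + 256 * γ₁ * K, by positivity, by norm_num,
    by have : 0 < γ₁ := by linarith
       positivity, ?_⟩
  intro k hk p q hp hq Ω _ μ _ A hA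
  have hk0 : (0 : ℝ) < k := by exact_mod_cast (by omega : 0 < k)
  have hl0 : 0 < Real.log k := Real.log_pos (by exact_mod_cast (by omega : 1 < k))
  set l := Real.log k with hl
  have hkl : (k : ℝ) = Real.exp l := (Real.exp_log hk0).symm
  have hkp : k * (p : ℝ) = γ₁ * l := by rw [hp]; field_simp
  have hkq : k * (q : ℝ) = γ₂ * l := by rw [hq]; field_simp
  have hqp : q ≤ p := by
    have : (q : ℝ) ≤ p := by
      rw [hp, hq]
      gcongr
    exact this
  set P := edgeProb k p q with hP
  set S := signProb k s with hS
  have hPp : ∀ i j, (P i j : ℝ) ≤ p := fun i j => edgeProb_le hqp i j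
  have hD : ∀ i, meanDegree P i = γ₁ * l + γ₂ * l - p := fun i => by
    rw [hP, meanDegree_edgeProb, hkp, hkq]
  have hD1 : ∀ i, 2 * l - 1 ≤ meanDegree P i := fun i => by
    rw [hD]
    nlinarith [p.2.2]
  have hD2 : ∀ i, l / 8 ≤ meanDegree P i := fun i => by
    have h1 : (p : ℝ) ≤ k * p :=
      le_mul_of_one_le_left p.2.1 (by exact_mod_cast (by omega : 1 ≤ k))
    rw [hD]
    nlinarith
  obtain ⟨ht1, ht2⟩ := htail (2 * k) k hk p p.2.1 p.2.2 (by push_cast; linarith) P S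
    (edgeProb_isSymm p q) (signProb_isSymm s) (edgeProb_apply_self p q) hPp
  rw [← hl] at ht1 ht2
  set N := K * Real.sqrt l with hN
  set G := regularSet (meanAdj P S) (P.map fun x => (x : ℝ)) (l / 8) N with hG
  have hGm : MeasurableSet G := measurableSet_regularSet _ _ _ _
  have hbad : (pairsMeasure P S).real (assemble ⁻¹' G)ᶜ ≤
      (4 + 2 * Real.exp (3 / 4)) * (k : ℝ) ^ (-(1 / 4) : ℝ) := by
    refine (pairsMeasure_compl_regularSet_le P S (l / 8) N).trans ?_
    have h1 : ∑ i, (pairsMeasure P S).real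
        {ω | ∑ j, symmetrize (fun e => (ω e).1) i j ≤ l / 8} ≤
        2 * Real.exp (3 / 4) * Real.exp (-(l / 4)) := by
      -- The Chernoff exponent `l / 4 - 3 / 4 * (2 * l - 1)` is `3 / 4 - 5 / 4 * l`; the union over
      -- `2 * k = 2 * exp l` nodes leaves `exp (-l / 4)`, which fixes the exponent `1 / 4`.
      calc _ ≤ ∑ _i : Fin (2 * k), Real.exp (3 / 4 - 5 / 4 * l) := by
            refine Finset.sum_le_sum fun i _ => (measure_row_sum_le P S (edgeProb_isSymm p q)
              (edgeProb_apply_self p q) i (l / 8)).trans (Real.exp_le_exp.2 ?_)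
            linarith [hD1 i]
        _ = 2 * (Real.exp l * Real.exp (3 / 4 - 5 / 4 * l)) := by
            rw [Finset.sum_const, Finset.card_univ, Fintype.card_fin, nsmul_eq_mul, ← hkl]
            push_cast
            ring
        _ = _ := by
            rw [mul_assoc, ← Real.exp_add, ← Real.exp_add]
            congr 2
            ring
    have h2 : ((2 * k : ℕ) : ℝ) / (k : ℝ) ^ 2 ≤ 2 * Real.exp (-(l / 4)) := by
      have : ((2 * k : ℕ) : ℝ) / (k : ℝ) ^ 2 = 2 * Real.exp (-l) := by
        rw [Real.exp_neg, ← hkl]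
        push_cast
        field_simp
      rw [this]
      gcongr
      linarith
    have h3 : (k : ℝ) ^ (-(1 / 4) : ℝ) = Real.exp (-(l / 4)) := by
      rw [Real.rpow_def_of_pos hk0, ← hl]
      congr 1
      ring
    rw [h3]
    linarith
  have hprob : 1 - (4 + 2 * Real.exp (3 / 4)) * (k : ℝ) ^ (-(1 / 4) : ℝ) ≤ μ.real (A ⁻¹' G) := by
    have e1 : μ.real (A ⁻¹' G) = (pairsMeasure P S).real (assemble ⁻¹' G) := by
      rw [measureReal_def, measureReal_def, ← Measure.map_apply_of_aemeasurable hA.aemeasurable hGm,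
        hA.map_eq, ← Measure.map_apply measurable_assemble hGm]
      rfl
    have e2 := probReal_compl_eq_one_sub (μ := pairsMeasure P S) (measurable_assemble hGm)
    rw [e1]
    linarith
  refine hprob.trans (measureReal_mono fun ω hω => ?_)
  refine (opNorm_normLaplacian_sub_le (by positivity) (by positivity) p.2.1 hPp hD2 hω).trans_eq ?_
  have e3 : ((2 * k : ℕ) : ℝ) * p = 2 * (γ₁ * l) := by push_cast; linarith
  have e4 : l ^ (-(1 / 2) : ℝ) = Real.sqrt l / l := by
    rw [Real.rpow_neg hl0.le, ← Real.sqrt_eq_rpow, Real.sqrt_div_self]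
  rw [e3, e4, hN]
  field_simp
  ring
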